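/- A $d$-dimensional lattice $L\subset\mathbb R^n$ is the set of integer combinations of $d$ linearly independent vectors (the columns of a matrix $B$), $\det(L)=\sqrt{\det(B^{T}B)}$, and $L^*=\{y\in\mathrm{span}(L):\langle y,x\rangle\in\mathbb Z\ \ \forall x\in L\}$ is its dual. A lattice subspace of $L^*$ is a linear subspace having a basis of vectors in $L^*$. The covering radius is $\mu(L)=\inf\{r\ge 0:\mathrm{span}(L)\subseteq L+rB_2^n\}$, where $B_2^n$ is the closed Euclidean unit ball. Put $$\eta_{\det}(L)=\max_{W}\det(L^*\cap W)^{-1/\dim W},\qquad \eta^{\circ}_\mu(L)=\sup_{R\in\mathbb R^{n\times n}\text{ non-singular}}\frac{\mu(RL)}{\sqrt{\mathrm{tr}(R^{T}R)}},$$ where $W$ ranges over the lattice subspaces of $L^*$ of positive dimension. Let $C^{\det}_{(\mu,\circ)}(n)$ be the smallest number such that $\eta^\circ_\mu(L)\le C^{\det}_{(\mu,\circ)}(n)\,\eta_{\det}(L)$ for every $n$-dimensional lattice $L\subset\mathbb R^n$, and let $C_{KL}(n)$ be the smallest number such that $$\mu(L)\le C_{KL}(n)\max_{W}\sqrt{\dim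 W}\,\det(L^*\cap W)^{-1/\dim W}$$ for every lattice $L\subset\mathbb R^n$ (for the zero lattice, the maximum over the empty set is read as $0$). **Theorem.** For every $n\ge 1$ these smallest numbers exist, are positive and finite, and $$C^{\det}_{(\mu,\circ)}(n)\le C_{KL}(n)\le K\,(1+\log n)\,C^{\det}_{(\mu,\circ)}(n)$$ for a universal constant $K>0$. Consequently the $\ell_2$ Kannan–Lovász conjecture, i.e. $C_{KL}(n)\le\mathrm{poly}\log n$ (there are $A,k$ with $C_{KL}(n)\le A(\log n)^k$ for all $n\ge2$), holds if and only if $C^{\det}_{(\mu,\circ)}(n)\le\mathrm{poly}\log n$. -/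

import Mathlib

open scoped ENNReal NNReal

noncomputable section

namespace EuclLattice

/-- The space `ℝⁿ` with its Euclidean norm and inner product. -/
abbrev E (n : ℕ) : Type := EuclideanSpace ℝ (Fin n)

/-- `b = (b₁, …, b_d)` is a basis of the lattice `L ⊂ ℝⁿ`: the vectors `bᵢ` are linearly
independent over `ℝ`, and `L` is the set of their integer linear combinations. -/
def IsBasisOf {n d : ℕ} (b : Fin d → E n) (L : Submodule ℤ (E n)) : Prop :=
  LinearIndependent ℝ b ∧ Submodule.span ℤ (Set.range b) = L

/-- `L` is a `d`-dimensional lattice in `ℝⁿ`. -/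
def IsLatticeOfDim {n : ℕ} (d : ℕ) (L : Submodule ℤ (E n)) : Prop :=
  ∃ b : Fin d → E n, IsBasisOf b L

/-- `L` is a lattice in `ℝⁿ`, of any dimension `d`. -/
def IsLattice {n : ℕ} (L : Submodule ℤ (E n)) : Prop :=
  ∃ d : ℕ, IsLatticeOfDim d L

/-- `√(det (BᵀB))` for the matrix `B` with columns `b₁, …, b_d`. -/
def gramVol {n d : ℕ} (b : Fin d → E n) : ℝ :=
  Real.sqrt (Matrix.gram ℝ b).det

/-- `√(det (BᵀB))` is the same for all bases of a lattice. -/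
theorem gramVol_eq_of_isBasisOf {n d e : ℕ} {L : Submodule ℤ (E n)} {b : Fin d → E n}
    {c : Fin e → E n} (hb : IsBasisOf b L) (hc : IsBasisOf c L) : gramVol b = gramVol c := by
  obtain ⟨hbi, hbL⟩ := hb
  obtain ⟨hci, hcL⟩ := hc
  have hbZ : LinearIndependent ℤ b := hbi.restrict_scalars (fun x y h => by simpa using h)
  have hcZ : LinearIndependent ℤ c := hci.restrict_scalars (fun x y h => by simpa using h)
  subst hbL
  let B : Module.Basis (Fin d) ℤ (Submodule.span ℤ (Set.range b)) := Module.Basis.span hbZ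
  let C : Module.Basis (Fin e) ℤ (Submodule.span ℤ (Set.range b)) :=
    (Module.Basis.span hcZ).map (LinearEquiv.ofEq _ _ hcL)
  have hB : ∀ i, (B i : E n) = b i := fun i => by simp [B, Module.Basis.span_apply]
  have hC : ∀ i, (C i : E n) = c i := fun i => by simp [C, Module.Basis.span_apply]
  have hde : d = e := by
    have h1 := Module.finrank_eq_card_basis B
    have h2 := Module.finrank_eq_card_basis C
    simp only [Fintype.card_fin] at h1 h2
    omega
  subst hde
  let P : Matrix (Fin d) (Fin d) ℤ := B.toMatrix C
  have hP : ∀ j, c j = ∑ i, (P i j : ℝ) • b i := fun j => by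
    have h := B.sum_toMatrix_smul_self C j
    have h' := congrArg (Subtype.val) h
    rw [hC] at h'
    rw [← h', AddSubmonoidClass.coe_finsetSum]
    refine Finset.sum_congr rfl fun i _ => ?_
    rw [Int.cast_smul_eq_zsmul, ← hB]
    rfl
  have hdet : (P.map (Int.cast : ℤ → ℝ)).det ^ 2 = 1 := by
    have hu : IsUnit P.det := by
      have h := B.toMatrix_mul_toMatrix_flip C
      exact (Matrix.isUnit_iff_isUnit_det _).1 (.of_mul_eq_one _ h)
    have h2 : P.det ^ 2 = 1 := by
      rcases Int.isUnit_iff.1 hu with h | h <;> simp [h]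
    have h3 : (P.map (Int.cast : ℤ → ℝ)).det = (P.det : ℝ) :=
      ((Int.castRingHom ℝ).map_det P).symm
    rw [h3]
    exact_mod_cast h2
  have hG : (Matrix.gram ℝ c) =
      (P.map (Int.cast : ℤ → ℝ)).transpose *
        (Matrix.gram ℝ b) * P.map (Int.cast : ℤ → ℝ) := by
    ext i j
    simp only [Matrix.gram_apply, hP, sum_inner, inner_sum, real_inner_smul_left,
      real_inner_smul_right, Matrix.mul_apply, Matrix.transpose_apply, Matrix.map_apply,
      Finset.sum_mul]
    refine Finset.sum_congr rfl fun k _ => Finset.sum_congr rfl fun l _ => ?_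
    ring
  unfold gramVol
  rw [hG, Matrix.det_mul, Matrix.det_mul, Matrix.det_transpose]
  congr 1
  linear_combination (-(Matrix.gram ℝ b).det) * hdet

open Classical in
/-- The determinant `det(L) = √(det (BᵀB))` of a lattice, for any basis `B` of `L`
(and `0` if `L` is not a lattice). -/
def latticeDet {n : ℕ} (L : Submodule ℤ (E n)) : ℝ :=
  if h : IsLattice L then gramVol h.choose_spec.choose else 0

/-- The determinant may be computed from any basis. -/
theorem latticeDet_eq {n d : ℕ} {L : Submodule ℤ (E n)} {b : Fin d → E n}
    (hb : IsBasisOf b L) : latticeDet L = gramVol b := by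
  have h : IsLattice L := ⟨d, b, hb⟩
  rw [latticeDet, dif_pos h]
  exact gramVol_eq_of_isBasisOf h.choose_spec.choose_spec hb

/-- The dual lattice `L* = {y ∈ span(L) : ⟨y, x⟩ ∈ ℤ for all x ∈ L}`. -/
def dual {n : ℕ} (L : Submodule ℤ (E n)) : Submodule ℤ (E n) where
  carrier := {y | y ∈ Submodule.span ℝ (L : Set (E n)) ∧ ∀ x ∈ L, ∃ k : ℤ, inner ℝ y x = (k : ℝ)}
  zero_mem' := ⟨zero_mem _, fun x _ => ⟨0, by simp⟩⟩
  add_mem' := by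
    rintro y z ⟨hy, hy'⟩ ⟨hz, hz'⟩
    refine ⟨add_mem hy hz, fun x hx => ?_⟩
    obtain ⟨k, hk⟩ := hy' x hx
    obtain ⟨l, hl⟩ := hz' x hx
    exact ⟨k + l, by rw [inner_add_left, hk, hl]; push_cast; rfl⟩
  smul_mem' := by
    rintro m y ⟨hy, hy'⟩
    refine ⟨zsmul_mem hy m, fun x hx => ?_⟩
    obtain ⟨k, hk⟩ := hy' x hx
    refine ⟨m * k, ?_⟩
    rw [← Int.cast_smul_eq_zsmul ℝ m y, real_inner_smul_left, hk]
    push_cast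
    rfl

/-- `W` is a lattice subspace of `M`: it has a basis consisting of vectors of `M`. -/
def IsLatticeSubspace {n : ℕ} (M : Submodule ℤ (E n)) (W : Submodule ℝ (E n)) : Prop :=
  ∃ b : Module.Basis (Fin (Module.finrank ℝ W)) ℝ W, ∀ i, (b i : E n) ∈ M

/-- The lattice `M ∩ W`. -/
def slice {n : ℕ} (M : Submodule ℤ (E n)) (W : Submodule ℝ (E n)) : Submodule ℤ (E n) :=
  M ⊓ W.restrictScalars ℤ

/-- The covering radius `μ(L) = inf {r ≥ 0 : span(L) ⊆ L + r B}`, `B` the closed Euclidean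
unit ball. -/
def coveringRadius {n : ℕ} (L : Submodule ℤ (E n)) : ℝ≥0∞ :=
  ⨅ (r : ℝ≥0) (_ : ∀ x ∈ Submodule.span ℝ (L : Set (E n)), ∃ y ∈ L, ‖x - y‖ ≤ r), (r : ℝ≥0∞)

/-- `η_det(L)`: the maximum of `det(L* ∩ W) ^ (-1 / dim W)` over all lattice subspaces `W` of
`L*` of positive dimension. -/
def etaDet {n : ℕ} (L : Submodule ℤ (E n)) : ℝ≥0∞ :=
  ⨆ (W : Submodule ℝ (E n)) (_ : IsLatticeSubspace (dual L) W) (_ : 1 ≤ Module.finrank ℝ W),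
    ENNReal.ofReal (latticeDet (slice (dual L) W) ^ (-(1 / (Module.finrank ℝ W : ℝ))))

/-- The maximum of `√d · det(L* ∩ W) ^ (-1 / d)`, `d = dim W`, over all lattice subspaces `W` of
`L*` of positive dimension. -/
def klBound {n : ℕ} (L : Submodule ℤ (E n)) : ℝ≥0∞ :=
  ⨆ (W : Submodule ℝ (E n)) (_ : IsLatticeSubspace (dual L) W) (_ : 1 ≤ Module.finrank ℝ W),
    ENNReal.ofReal (Real.sqrt (Module.finrank ℝ W) *
      latticeDet (slice (dual L) W) ^ (-(1 / (Module.finrank ℝ W : ℝ))))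

/-- The image `R L` of `L` under a matrix `R`. -/
def matImage {n : ℕ} (R : Matrix (Fin n) (Fin n) ℝ) (L : Submodule ℤ (E n)) :
    Submodule ℤ (E n) :=
  L.map ((Matrix.toEuclideanLin R).restrictScalars ℤ)

/-- `η°_μ(L)`: the supremum of `μ(R L) / √(tr(Rᵀ R))` over all non-singular `R`. -/
def etaMuCirc {n : ℕ} (L : Submodule ℤ (E n)) : ℝ≥0∞ :=
  ⨆ (R : Matrix (Fin n) (Fin n) ℝ) (_ : R.det ≠ 0),
    coveringRadius (matImage R L) / ENNReal.ofReal (Real.sqrt (R.transpose * R).trace)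

/-- `C^det_(μ,∘)(n)`: the smallest `C` with `η°_μ(L) ≤ C · η_det(L)` for every `n`-dimensional
lattice `L ⊂ ℝⁿ`. -/
def detConst (n : ℕ) : ℝ≥0∞ :=
  sInf {C : ℝ≥0∞ | ∀ L : Submodule ℤ (E n), IsLatticeOfDim n L → etaMuCirc L ≤ C * etaDet L}

/-- `C_KL(n)`: the smallest `C` with
`μ(L) ≤ C · max_W √(dim W) · det(L* ∩ W) ^ (-1 / dim W)` for every lattice `L ⊂ ℝⁿ`. -/
def klConst (n : ℕ) : ℝ≥0∞ :=
  sInf {C : ℝ≥0∞ | ∀ L : Submodule ℤ (E n), IsLattice L → coveringRadius L ≤ C * klBound L}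

/-- `f(n) ≤ poly log n`. -/
def PolylogBounded (f : ℕ → ℝ≥0∞) : Prop :=
  ∃ (A : ℝ) (k : ℕ), ∀ n : ℕ, 2 ≤ n → f n ≤ ENNReal.ofReal (A * Real.log n ^ k)

/-- The `ℓ₂` Kannan–Lovász conjecture. -/
def KLConjecture : Prop := PolylogBounded klConst

end EuclLattice

end

/-! The inequality `detConst n ≤ klConst n` is an arithmetic-geometric mean estimate. The transpose
of R maps the dual of RL into the dual of L and multiplies the squared volume of d independent
vectors by at most (tr(RᵀR)/d)^d (`gramDet_map_le_pow_mul`). Hence every term √d·det^(-1/d) for RL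
is at most √tr(RᵀR) times a term of η_det(L).

For the logarithmic converse, L* is rescaled along its canonical (Harder-Narasimhan) filtration.
Choose a sublattice whose Gram determinant has nearly minimal d-th root t, d being its rank; divide
its span V by √t; continue with the projection of L* orthogonal to V. Having all Gram determinants
at least 1 passes from the part in V and the projection to the whole (`GramDetGeOne.of_inf_of_map`),
so the rescaled lattice L'* has η_det(L') ≤ 1. If R is the scaling, then RL' = L and μ(L) ≤
`detConst n`·√tr(RᵀR), where tr(RᵀR) is the sum of the 1/t_j. The slopes t_j essentially increase,
so up to a factor 2 each t_j bounds the slope of a sublattice of rank d > j. Thus 1/t_j ≤ 2·`klBound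
L`²/(j+1), and the harmonic sum produces the logarithm (`exists_scaling`,
`IsBasisOf.coveringRadius_le_detConst_mul`). A lattice of lower dimension is first completed by a
scaled orthonormal basis of the complement of its span.

Finiteness follows from a crude transference bound, μ(L) ≤ √(3^n)/λ₁(L*) (`exists_near_integral`),
and positivity from ℤⁿ. -/

noncomputable section

namespace EuclLattice

/-! ### Gram determinants: block formula and monotonicity. -/

section

variable {F : Type*} [NormedAddCommGroup F] [InnerProductSpace ℝ F]

/-- The Gram determinant of a finite family of vectors. -/
def gramDet {ι : Type*} [Fintype ι] [DecidableEq ι] (b : ι → F) : ℝ := (Matrix.gram ℝ b).det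

section gramDet

variable {ι κ : Type*} [Fintype ι] [DecidableEq ι] [Fintype κ] [DecidableEq κ]

theorem gramDet_nonneg (b : ι → F) : 0 ≤ gramDet b := (Matrix.posSemidef_gram ℝ b).det_nonneg

theorem gramDet_pos {b : ι → F} (hb : LinearIndependent ℝ b) : 0 < gramDet b :=
  (Matrix.posDef_gram_of_linearIndependent hb).det_pos

theorem gramDet_ne_zero_iff {b : ι → F} : gramDet b ≠ 0 ↔ LinearIndependent ℝ b :=
  Matrix.det_gram_ne_zero_iff_linearIndependent

theorem gramDet_of_isEmpty [IsEmpty ι] (b : ι → F) : gramDet b = 1 := Matrix.det_isEmpty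

theorem gramDet_reindex (e : ι ≃ κ) (b : κ → F) : gramDet (b ∘ e) = gramDet b := by
  exact Matrix.det_submatrix_equiv_self e (Matrix.gram ℝ b)

theorem gramDet_fin_one (b : Fin 1 → F) : gramDet b = ‖b 0‖ ^ 2 := by
  simp [gramDet, Matrix.gram_apply]

theorem gramDet_orthonormal {b : ι → F} (hb : Orthonormal ℝ b) : gramDet b = 1 := by
  rw [gramDet, Matrix.gram_eq_one_iff_orthonormal.2 hb, Matrix.det_one]

theorem gramDet_sum_smul (P : Matrix ι ι ℝ) {b c : ι → F} (h : ∀ j, c j = ∑ i, P i j • b i) :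
    gramDet c = P.det ^ 2 * gramDet b := by
  have hG : Matrix.gram ℝ c = P.transpose * Matrix.gram ℝ b * P := by
    ext i j
    simp only [Matrix.gram_apply, h, sum_inner, inner_sum, real_inner_smul_left,
      real_inner_smul_right, Matrix.mul_apply, Matrix.transpose_apply, Finset.sum_mul]
    refine Finset.sum_congr rfl fun k _ => Finset.sum_congr rfl fun l _ => ?_
    ring
  unfold gramDet
  rw [hG, Matrix.det_mul, Matrix.det_mul, Matrix.det_transpose]
  ring

theorem gramDet_smul (a : ℝ) (b : ι → F) :
    gramDet (fun i => a • b i) = (a ^ 2) ^ Fintype.card ι * gramDet b := by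
  rw [gramDet_sum_smul (a • (1 : Matrix ι ι ℝ)) (b := b)]
  · rw [Matrix.det_smul, Matrix.det_one]
    ring
  · intro j
    simp [Matrix.one_apply]

/-- Replacing each v j by its component orthogonal to the span of u is a block unipotent change of
family, which keeps the determinant and makes the Gram matrix block diagonal. -/
theorem gramDet_sumElim (u : ι → F) (v : κ → F)
    [(Submodule.span ℝ (Set.range u)).HasOrthogonalProjection] :
    gramDet (Sum.elim u v) = gramDet u *
      gramDet (fun j => (Submodule.span ℝ (Set.range u))ᗮ.starProjection (v j)) := by
  set U := Submodule.span ℝ (Set.range u)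
  have hX : ∀ j, ∃ x : ι → ℝ, ∑ i, x i • u i = U.starProjection (v j) := fun j =>
    (Submodule.mem_span_range_iff_exists_fun ℝ).1 (U.starProjection_apply_mem (v j))
  choose x hx using hX
  have hv : ∀ j, U.starProjection (v j) + Uᗮ.starProjection (v j) = v j := fun j =>
    U.starProjection_add_starProjection_orthogonal (v j)
  rw [gramDet_sum_smul (Matrix.fromBlocks 1 (Matrix.of fun i j => x j i) 0 1)
    (b := Sum.elim u fun j => Uᗮ.starProjection (v j))]
  · rw [Matrix.det_fromBlocks_zero₂₁, Matrix.det_one, Matrix.det_one]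
    have : Matrix.gram ℝ (Sum.elim u fun j => Uᗮ.starProjection (v j)) =
        Matrix.fromBlocks (Matrix.gram ℝ u) 0 0
          (Matrix.gram ℝ fun j => Uᗮ.starProjection (v j)) := by
      ext (i | i) (j | j)
      · simp [Matrix.gram_apply]
      · simp only [Matrix.gram_apply, Sum.elim_inl, Sum.elim_inr, Matrix.fromBlocks_apply₁₂,
          Matrix.zero_apply]
        exact Submodule.inner_right_of_mem_orthogonal (K := U)
          (Submodule.subset_span (Set.mem_range_self i))
          (Uᗮ.starProjection_apply_mem _)
      · simp only [Matrix.gram_apply, Sum.elim_inl, Sum.elim_inr, Matrix.fromBlocks_apply₂₁,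
          Matrix.zero_apply]
        exact Submodule.inner_left_of_mem_orthogonal (K := U)
          (Submodule.subset_span (Set.mem_range_self j))
          (Uᗮ.starProjection_apply_mem _)
      · simp [Matrix.gram_apply]
    unfold gramDet
    rw [this, Matrix.det_fromBlocks_zero₂₁]
    ring
  · rintro (j | j)
    · simp [Matrix.one_apply]
    · simp [Matrix.one_apply, hx]

theorem one_le_det_one_add {D : Matrix ι ι ℝ} (hD : D.PosSemidef) : 1 ≤ (1 + D).det := by
  have hE : (1 + D).IsHermitian := Matrix.isHermitian_one.add hD.1
  rw [hE.det_eq_prod_eigenvalues]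
  refine Finset.one_le_prod fun i _ => ?_
  have h1 := hE.eigenvalues_eq i
  set w : ι → ℝ := ⇑(hE.eigenvectorBasis i)
  have h2 : star w ⬝ᵥ w = 1 := by
    have := hE.eigenvectorBasis.orthonormal.1 i
    have h3 : inner ℝ (hE.eigenvectorBasis i) (hE.eigenvectorBasis i) = (1 : ℝ) := by
      rw [real_inner_self_eq_norm_sq, this]; norm_num
    rw [EuclideanSpace.inner_eq_star_dotProduct] at h3
    rw [dotProduct_comm]
    exact h3
  have h4 := hD.dotProduct_mulVec_nonneg w
  simp only [RCLike.ofReal_real_eq_id, id_eq]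
  rw [h1, Matrix.add_mulVec, Matrix.one_mulVec, dotProduct_add, h2]
  simpa using h4

-- If A = CᴴC is invertible, B is the congruence by C of 1 + D with D positive semidefinite, and the
-- eigenvalues of 1 + D are at least 1.
open scoped MatrixOrder Matrix.Norms.L2Operator in
theorem det_le_det_of_posSemidef {A B : Matrix ι ι ℝ} (hA : A.PosSemidef)
    (hBA : (B - A).PosSemidef) : A.det ≤ B.det := by
  have hB : B.PosSemidef := by simpa using hA.add hBA
  by_cases h0 : A.det = 0
  · rw [h0]; exact hB.det_nonneg
  obtain ⟨C, hC⟩ : ∃ C : Matrix ι ι ℝ, A = C.conjTranspose * C :=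
    CStarAlgebra.nonneg_iff_eq_star_mul_self.1 hA.nonneg
  have hCu : IsUnit C.det := by
    rw [isUnit_iff_ne_zero]
    rintro h
    exact h0 (by rw [hC, Matrix.det_mul, h, mul_zero])
  have hD : (C⁻¹.conjTranspose * (B - A) * C⁻¹).PosSemidef := hBA.conjTranspose_mul_mul_same C⁻¹
  have h1 := one_le_det_one_add hD
  have h2 : B = C.conjTranspose * (1 + C⁻¹.conjTranspose * (B - A) * C⁻¹) * C := by
    have e1 : C⁻¹ * C = 1 := Matrix.nonsing_inv_mul C hCu
    have e2 : C.conjTranspose * C⁻¹.conjTranspose = 1 := by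
      rw [← Matrix.conjTranspose_mul, e1, Matrix.conjTranspose_one]
    calc B = A + (B - A) := by abel
      _ = C.conjTranspose * C + (C.conjTranspose * C⁻¹.conjTranspose) * (B - A) * (C⁻¹ * C) := by
        rw [e1, e2, ← hC]; simp
      _ = _ := by noncomm_ring
  have h3 : B.det = A.det * (1 + C⁻¹.conjTranspose * (B - A) * C⁻¹).det := by
    conv_lhs => rw [h2]
    rw [Matrix.det_mul, Matrix.det_mul, hC, Matrix.det_mul]
    ring
  rw [h3]
  nlinarith [hA.det_nonneg]

theorem gramDet_map_le (b : ι → F) (f : F →L[ℝ] F) (hf : ‖f‖ ≤ 1) :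
    gramDet (fun i => f (b i)) ≤ gramDet b := by
  refine det_le_det_of_posSemidef (Matrix.posSemidef_gram ℝ _) ?_
  have h1 := Matrix.posSemidef_opNorm_smul_gram_sub_gram b f
  have h2 : ((1 - ‖f‖ ^ 2) • Matrix.gram ℝ b).PosSemidef :=
    (Matrix.posSemidef_gram ℝ b).smul (by nlinarith [norm_nonneg f])
  have h3 := h2.add h1
  convert h3 using 1
  rw [sub_smul, one_smul, sub_add_sub_cancel]
  rfl

/-- The block formula projects away from the span of u only. As that span lies in V, projecting
further onto Vᗮ is a contraction and can only decrease the second factor. -/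
theorem gramDet_mul_le_gramDet_sumElim [FiniteDimensional ℝ F] (V : Submodule ℝ F) {u : ι → F}
    (hu : ∀ i, u i ∈ V) (v : κ → F) :
    gramDet u * gramDet (fun j => Vᗮ.starProjection (v j)) ≤ gramDet (Sum.elim u v) := by
  rw [gramDet_sumElim]
  refine mul_le_mul_of_nonneg_left ?_ (gramDet_nonneg u)
  set U := Submodule.span ℝ (Set.range u)
  have hUV : U ≤ V := Submodule.span_le.2 (by rintro _ ⟨i, rfl⟩; exact hu i)
  have h := gramDet_map_le (fun j => Uᗮ.starProjection (v j)) Vᗮ.starProjection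
    (Submodule.starProjection_norm_le _)
  have h2 : ∀ j, Vᗮ.starProjection (Uᗮ.starProjection (v j)) =
      Vᗮ.starProjection (v j) := fun j => by
    rw [← ContinuousLinearMap.comp_apply,
      Submodule.starProjection_comp_starProjection_of_le (Submodule.orthogonal_le hUV)]
  simpa only [h2] using h

end gramDet

end

/-! ### Volumes under linear maps; change of basis; integer vectors. -/

section

variable {F : Type*} [NormedAddCommGroup F] [InnerProductSpace ℝ F]
variable {G : Type*} [NormedAddCommGroup G] [InnerProductSpace ℝ G]
variable {ι κ : Type*} [Fintype ι] [DecidableEq ι] [Fintype κ] [DecidableEq κ]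

/-- Arithmetic-geometric mean inequality for the eigenvalues. -/
theorem det_le_trace_div_pow {A : Matrix ι ι ℝ} (hA : A.PosSemidef) [Nonempty ι] :
    A.det ≤ (A.trace / Fintype.card ι) ^ Fintype.card ι := by
  have hc : (0 : ℝ) < Fintype.card ι := by exact_mod_cast Fintype.card_pos
  rw [hA.1.det_eq_prod_eigenvalues, hA.1.trace_eq_sum_eigenvalues]
  simp only [RCLike.ofReal_real_eq_id, id_eq]
  set z := hA.1.eigenvalues
  have hz : ∀ i, 0 ≤ z i := fun i => hA.eigenvalues_nonneg i
  have h := Real.geom_mean_le_arith_mean Finset.univ (fun _ : ι => (1 : ℝ)) z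
    (fun _ _ => zero_le_one) (by simpa using hc) (fun i _ => hz i)
  simp only [Real.rpow_one, Finset.sum_const, Finset.card_univ, nsmul_eq_mul, mul_one,
    one_mul] at h
  have h0 : 0 ≤ ∏ i, z i := Finset.prod_nonneg fun i _ => hz i
  calc ∏ i, z i = ((∏ i, z i) ^ ((Fintype.card ι : ℝ)⁻¹)) ^ Fintype.card ι :=
        (Real.rpow_inv_natCast_pow h0 Fintype.card_ne_zero).symm
    _ ≤ _ := by gcongr

-- Expanding ‖T x‖² in an orthonormal basis g of the target gives the sum of ⟨x, T*g_k⟩²; for each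
-- k, Bessel for f is compared with Parseval for e.
omit [DecidableEq ι] [DecidableEq κ] in
theorem sum_norm_sq_map_le [FiniteDimensional ℝ F] [FiniteDimensional ℝ G] (T : F →ₗ[ℝ] G)
    (e : OrthonormalBasis κ ℝ F) {f : ι → F} (hf : Orthonormal ℝ f) :
    ∑ i, ‖T (f i)‖ ^ 2 ≤ ∑ k, ‖T (e k)‖ ^ 2 := by
  let g := stdOrthonormalBasis ℝ G
  have h1 : ∀ x : F, ‖T x‖ ^ 2 = ∑ k, (inner ℝ x (T.adjoint (g k))) ^ 2 := fun x => by
    rw [← g.sum_sq_norm_inner_right (T x)]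
    refine Finset.sum_congr rfl fun k _ => ?_
    rw [Real.norm_eq_abs, sq_abs, LinearMap.adjoint_inner_right, real_inner_comm]
  simp only [h1]
  rw [Finset.sum_comm, Finset.sum_comm (γ := κ)]
  refine Finset.sum_le_sum fun k _ => ?_
  have h2 := hf.sum_inner_products_le (T.adjoint (g k)) (s := Finset.univ)
  have h3 := e.sum_sq_norm_inner_right (T.adjoint (g k))
  simp only [Real.norm_eq_abs, sq_abs] at h2 h3
  exact h2.trans h3.ge

-- In an orthonormal basis of the span of b, both volumes carry the same factor det P², so only the
-- Gram matrix of the images of that basis matters; its trace is at most the squared Hilbert-Schmidt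
-- norm of T.
omit [DecidableEq κ] in
theorem gramDet_map_le_pow_mul [FiniteDimensional ℝ F] [FiniteDimensional ℝ G] [Nonempty ι]
    (T : F →ₗ[ℝ] G) (e : OrthonormalBasis κ ℝ F) (b : ι → F) :
    gramDet (fun i => T (b i)) ≤
      ((∑ k, ‖T (e k)‖ ^ 2) / Fintype.card ι) ^ Fintype.card ι * gramDet b := by
  have hS : 0 ≤ ∑ k, ‖T (e k)‖ ^ 2 := Finset.sum_nonneg fun _ _ => sq_nonneg _
  by_cases hb : LinearIndependent ℝ b
  · let W := Submodule.span ℝ (Set.range b)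
    have hW : Module.finrank ℝ W = Fintype.card ι := finrank_span_eq_card hb
    let f : OrthonormalBasis ι ℝ W := (stdOrthonormalBasis ℝ W).reindex
      (Fintype.equivOfCardEq (by simp [hW]))
    have hbW : ∀ j, b j ∈ W := fun j => Submodule.subset_span (Set.mem_range_self j)
    let P : Matrix ι ι ℝ := Matrix.of fun i j => f.repr ⟨b j, hbW j⟩ i
    have hP : ∀ j, b j = ∑ i, P i j • (f i : F) := fun j => by
      have := congrArg (Subtype.val) (f.sum_repr ⟨b j, hbW j⟩)
      simpa [P] using this.symm
    have hf : Orthonormal ℝ (fun i => (f i : F)) := f.orthonormal.comp_linearIsometry W.subtypeₗᵢ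
    have hTP : ∀ j, T (b j) = ∑ i, P i j • T (f i : F) := fun j => by
      conv_lhs => rw [hP j]
      simp
    rw [gramDet_sum_smul P hTP, gramDet_sum_smul P hP, gramDet_orthonormal hf, mul_one, mul_comm]
    refine mul_le_mul_of_nonneg_right ?_ (sq_nonneg _)
    refine (det_le_trace_div_pow (Matrix.posSemidef_gram ℝ _)).trans ?_
    have htr : (Matrix.gram ℝ fun i => T (f i : F)).trace = ∑ i, ‖T (f i : F)‖ ^ 2 := by
      simp [Matrix.trace, Matrix.gram_apply]
    rw [htr]
    have := sum_norm_sq_map_le T e hf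
    have h0 : 0 ≤ ∑ i, ‖T (f i : F)‖ ^ 2 := Finset.sum_nonneg fun _ _ => sq_nonneg _
    gcongr
  · have h1 : gramDet b = 0 := by
      by_contra h; exact hb (gramDet_ne_zero_iff.1 h)
    have h2 : gramDet (fun i => T (b i)) = 0 := by
      by_contra h; exact hb (LinearIndependent.of_comp T (gramDet_ne_zero_iff.1 h))
    rw [h1, h2, mul_zero]

/-- Two `ℤ`-bases of the same module have images with the same Gram determinant. -/
theorem gramDet_basis_eq {N : Type*} [AddCommGroup N] (B : Module.Basis ι ℤ N)
    (C : Module.Basis κ ℤ N) (f : N →ₗ[ℤ] F) :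
    gramDet (fun i => f (B i)) = gramDet (fun i => f (C i)) := by
  let e := B.indexEquiv C
  rw [← gramDet_reindex e]
  let C' := C.reindex e.symm
  have hC' : (fun i => f (C i)) ∘ e = fun i => f (C' i) := by
    ext i; simp [C']
  rw [hC']
  let P : Matrix ι ι ℤ := C'.toMatrix B
  have hP : ∀ j, f (B j) = ∑ i, (P.map (Int.cast : ℤ → ℝ)) i j • f (C' i) := fun j => by
    have h := congrArg f (C'.sum_toMatrix_smul_self B j)
    rw [← h, map_sum]
    refine Finset.sum_congr rfl fun i _ => ?_
    rw [map_zsmul, Matrix.map_apply, Int.cast_smul_eq_zsmul]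
  have hdet : (P.map (Int.cast : ℤ → ℝ)).det ^ 2 = 1 := by
    have hu : IsUnit P.det := by
      have h := C'.toMatrix_mul_toMatrix_flip B
      exact (Matrix.isUnit_iff_isUnit_det _).1 (.of_mul_eq_one _ h)
    have h2 : P.det ^ 2 = 1 := by
      rcases Int.isUnit_iff.1 hu with h | h <;> simp [h]
    have h3 : (P.map (Int.cast : ℤ → ℝ)).det = (P.det : ℝ) :=
      ((Int.castRingHom ℝ).map_det P).symm
    rw [h3]
    exact_mod_cast h2
  rw [gramDet_sum_smul _ hP, hdet, one_mul]

/-- A `ℤ`-independent family of vectors of integer coordinates is `ℝ`-independent, with Gram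
determinant at least `1`. -/
theorem linearIndependent_and_one_le_gramDet_of_int {d : Type*} [Fintype d]
    {c : ι → EuclideanSpace ℝ d}
    (hc : ∀ i k, ∃ z : ℤ, c i k = z) (hci : LinearIndependent ℤ c) :
    LinearIndependent ℝ c ∧ 1 ≤ gramDet c := by
  choose z hz using hc
  have hzi : LinearIndependent ℤ z := by
    rw [Fintype.linearIndependent_iff] at hci ⊢
    intro g hg
    refine hci g ?_
    ext k
    have := congrFun hg k
    simp only [Finset.sum_apply, Pi.smul_apply, smul_eq_mul, Pi.zero_apply] at this
    have h2 : ((∑ i, g i * z i k : ℤ) : ℝ) = 0 := by rw [this]; simp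
    push_cast at h2
    simpa [hz] using h2
  have h1 : LinearIndependent ℝ c := by
    have h2 := (linearIndependent_algebraMap_comp_iff (R := ℤ) (S := ℝ)).2 hzi
    have h3 := h2.map' (WithLp.linearEquiv 2 ℝ (d → ℝ)).symm.toLinearMap (LinearEquiv.ker _)
    have h4 : c = (WithLp.linearEquiv 2 ℝ (d → ℝ)).symm ∘ fun i => algebraMap ℤ ℝ ∘ z i := by
      ext i k
      simp [hz]
    rw [h4]
    exact h3
  refine ⟨h1, ?_⟩
  -- The Gram matrix is integral, and a positive integer is at least 1.
  let Q : Matrix ι ι ℤ := Matrix.of fun i j => ∑ k, z i k * z j k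
  have hQ : Matrix.gram ℝ c = Q.map (Int.castRingHom ℝ) := by
    ext i j
    simp [Q, Matrix.gram_apply, PiLp.inner_apply, hz, mul_comm]
  have h2 : gramDet c = (Q.det : ℝ) := by
    rw [gramDet, hQ]
    exact ((Int.castRingHom ℝ).map_det Q).symm
  have h3 := gramDet_pos h1
  rw [h2] at h3 ⊢
  have : 0 < Q.det := by exact_mod_cast h3
  exact_mod_cast this

end

/-! ### Modules all of whose Gram determinants are at least 1. -/

section

variable {F : Type*} [NormedAddCommGroup F] [InnerProductSpace ℝ F]

/-- Every `ℤ`-independent family of vectors of `M` has Gram determinant at least `1`. -/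
def GramDetGeOne (M : Submodule ℤ F) : Prop :=
  ∀ (d : ℕ) (c : Fin d → F), (∀ i, c i ∈ M) → LinearIndependent ℤ c → 1 ≤ gramDet c

theorem GramDetGeOne.one_le {M : Submodule ℤ F} (hM : GramDetGeOne M) {ι : Type*} [Fintype ι]
    [DecidableEq ι] {c : ι → F} (hc : ∀ i, c i ∈ M) (hci : LinearIndependent ℤ c) :
    1 ≤ gramDet c := by
  let e := (Fintype.equivFin ι).symm
  rw [← gramDet_reindex e]
  exact hM _ _ (fun i => hc _) (hci.comp _ e.injective)

/-- The orthogonal projection onto `Vᗮ`, as a `ℤ`-linear map. -/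
def orthProj [FiniteDimensional ℝ F] (V : Submodule ℝ F) : F →ₗ[ℤ] F :=
  (Vᗮ.starProjection : F →ₗ[ℝ] F).restrictScalars ℤ

@[simp]
theorem orthProj_apply [FiniteDimensional ℝ F] (V : Submodule ℝ F) (x : F) :
    orthProj V x = Vᗮ.starProjection x := rfl

theorem orthProj_eq_zero_iff [FiniteDimensional ℝ F] {V : Submodule ℝ F} {x : F} :
    Vᗮ.starProjection x = 0 ↔ x ∈ V := by
  rw [Submodule.starProjection_apply_eq_zero_iff, Submodule.orthogonal_orthogonal]

/-- The span N of the family modulo N ∩ V embeds in Vᗮ, hence is torsion-free and free. So N has a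
basis adapted to V, with the same Gram determinant as c, which is bounded below by the product of
the volumes inside V and in the projection. No discreteness is assumed: a ℤ-independent family that
is ℝ-dependent would have Gram determinant 0. -/
theorem GramDetGeOne.of_inf_of_map [FiniteDimensional ℝ F] {M : Submodule ℤ F}
    (V : Submodule ℝ F) (h1 : GramDetGeOne (M ⊓ V.restrictScalars ℤ))
    (h2 : GramDetGeOne (M.map (orthProj V))) : GramDetGeOne M := by
  classical
  intro d c hcM hc
  let N := Submodule.span ℤ (Set.range c)
  have hNM : N ≤ M := Submodule.span_le.2 (by rintro _ ⟨i, rfl⟩; exact hcM i)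
  let bc : Module.Basis (Fin d) ℤ N := Module.Basis.span hc
  have : Module.Finite ℤ N := Module.Finite.of_basis bc
  have : Module.Free ℤ N := Module.Free.of_basis bc
  let p : N →ₗ[ℤ] F := (orthProj V) ∘ₗ N.subtype
  let K := LinearMap.ker p
  have : Module.IsTorsionFree ℤ F := .trans_faithfulSMul ℤ ℝ F
  have : Module.IsTorsionFree ℤ (N ⧸ K) :=
    (LinearMap.quotKerEquivRange p).injective.moduleIsTorsionFree _ (fun a x => map_smul _ a x)
  have : Module.Free ℤ (N ⧸ K) := Module.free_of_finite_type_torsion_free'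
  let bK := Module.Free.chooseBasis ℤ K
  let bQ := Module.Free.chooseBasis ℤ (N ⧸ K)
  let B := bK.sumQuot bQ
  have hcB : gramDet c = gramDet (fun i => N.subtype (B i)) := by
    rw [← gramDet_basis_eq bc B N.subtype]
    congr 1
    ext i
    exact (congrArg Subtype.val (Module.Basis.span_apply hc i)).symm
  let u := fun i => N.subtype (B (Sum.inl i))
  let v := fun j => N.subtype (B (Sum.inr j))
  have huv : (fun i => N.subtype (B i)) = Sum.elim u v := by
    ext (i | i) <;> rfl
  have hu : ∀ i, u i ∈ V := fun i => by
    rw [← orthProj_eq_zero_iff]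
    have : B (Sum.inl i) = bK i := Module.Basis.sumQuot_inl bK bQ i
    have h3 : p (B (Sum.inl i)) = 0 := by rw [this]; exact (bK i).2
    exact h3
  rw [hcB, huv]
  refine le_trans ?_ (gramDet_mul_le_gramDet_sumElim V hu v)
  have hu1 : 1 ≤ gramDet u := by
    refine h1.one_le (fun i => ⟨hNM (B (Sum.inl i)).2, hu i⟩) ?_
    exact (B.linearIndependent.comp _ Sum.inl_injective).map' N.subtype (Submodule.ker_subtype N)
  have hv1 : 1 ≤ gramDet (fun j => Vᗮ.starProjection (v j)) := by
    refine h2.one_le (fun j => ⟨v j, hNM (B (Sum.inr j)).2, rfl⟩) ?_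
    have h3 := bQ.linearIndependent.map' (K.liftQ p le_rfl)
      (Submodule.ker_liftQ_eq_bot _ _ _ le_rfl)
    have h4 : (fun j => Vᗮ.starProjection (v j)) = K.liftQ p le_rfl ∘ bQ := by
      ext1 j
      rw [Function.comp_apply, ← Module.Basis.sumQuot_inr bK bQ j, Submodule.liftQ_apply]
      rfl
    rw [h4]
    exact h3
  nlinarith

end

/-! ### Diagonal scalings, optimal slopes and lifting from a projection. -/

section

variable {F : Type*} [NormedAddCommGroup F] [InnerProductSpace ℝ F]

theorem GramDetGeOne.mono {M N : Submodule ℤ F} (hN : GramDetGeOne N) (h : M ≤ N) :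
    GramDetGeOne M := fun d c hc hci => hN d c (fun i => h (hc i)) hci

/-- The linear map `x ↦ ∑ aᵢ ⟨eᵢ, x⟩ eᵢ`. -/
def diagMap {ι : Type*} [Fintype ι] (e : ι → F) (a : ι → ℝ) : F →ₗ[ℝ] F :=
  ∑ i, (innerₛₗ ℝ (e i)).smulRight (a i • e i)

section diagMap

variable {ι κ : Type*} [Fintype ι] [Fintype κ]

theorem diagMap_apply (e : ι → F) (a : ι → ℝ) (x : F) :
    diagMap e a x = ∑ i, (inner ℝ (e i) x * a i) • e i := by
  simp [diagMap, smul_smul]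

theorem inner_diagMap {e : ι → F} (he : Orthonormal ℝ e) (a : ι → ℝ) (x : F) (j : ι) :
    inner ℝ (e j) (diagMap e a x) = a j * inner ℝ (e j) x := by
  rw [diagMap_apply, he.inner_right_fintype, mul_comm]

theorem diagMap_apply_self {e : ι → F} (he : Orthonormal ℝ e) (a : ι → ℝ) (i : ι) :
    diagMap e a (e i) = a i • e i := by
  classical
  rw [diagMap_apply]
  simp [orthonormal_iff_ite.1 he]

theorem eq_zero_of_diagMap_eq_zero {e : ι → F} (he : Orthonormal ℝ e) {a : ι → ℝ}
    (ha : ∀ i, a i ≠ 0) {x : F} (hx : x ∈ Submodule.span ℝ (Set.range e))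
    (h : diagMap e a x = 0) : x = 0 := by
  have h1 : ∀ j, inner ℝ (e j) x = 0 := fun j => by
    have := inner_diagMap he a x j
    rw [h, inner_zero_right] at this
    exact (mul_eq_zero.1 this.symm).resolve_left (ha j)
  have h2 : x ∈ (Submodule.span ℝ (Set.range e))ᗮ := by
    rw [Submodule.mem_orthogonal]
    intro u hu
    induction hu using Submodule.span_induction with
    | mem y hy => obtain ⟨i, rfl⟩ := hy; exact h1 i
    | zero => simp
    | add y z _ _ hy hz => rw [inner_add_left, hy, hz, add_zero]
    | smul r y _ hy => rw [real_inner_smul_left, hy, mul_zero]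
  exact inner_self_eq_zero.1 (Submodule.inner_right_of_mem_orthogonal hx h2)

omit [Fintype ι] [Fintype κ] in
theorem orthonormal_sumElim {e : ι → F} {f : κ → F} (he : Orthonormal ℝ e) (hf : Orthonormal ℝ f)
    (h : ∀ i j, inner ℝ (e i) (f j) = 0) : Orthonormal ℝ (Sum.elim e f) := by
  classical
  rw [orthonormal_iff_ite] at *
  rintro (i | i) (j | j)
  · simp [he]
  · simp [h]
  · simp [real_inner_comm, h]
  · simp [hf]

end diagMap

theorem linearIndependent_int_of_real {ι : Type*} {b : ι → F} (hb : LinearIndependent ℝ b) :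
    LinearIndependent ℤ b := hb.restrict_scalars (fun x y h => by simpa using h)

/-- The infimum `t` of `gramDet c ^ (1 / d)` over the nonempty `ℤ`-independent families of `M`. -/
theorem exists_optimal_slope {M : Submodule ℤ F} {c₀ : ℝ} (hc₀ : 0 < c₀)
    (hM : ∀ (d : ℕ) (c : Fin d → F), (∀ i, c i ∈ M) → LinearIndependent ℤ c → c₀ ^ d ≤ gramDet c)
    {x : F} (hx : x ∈ M) (hx0 : x ≠ 0) :
    ∃ t : ℝ, 0 < t ∧
      (∀ (d : ℕ) (c : Fin d → F), (∀ i, c i ∈ M) → LinearIndependent ℤ c → t ^ d ≤ gramDet c) ∧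
      ∀ δ : ℝ, 1 < δ → ∃ (k : ℕ) (b : Fin k → F), 0 < k ∧ (∀ i, b i ∈ M) ∧
        LinearIndependent ℤ b ∧ gramDet b ≤ (δ * t) ^ k := by
  -- The slopes. Their infimum is not shown to be attained; the factor δ makes up for this.
  let S : Set ℝ := {s | 0 ≤ s ∧ ∃ (d : ℕ) (c : Fin d → F), 0 < d ∧ (∀ i, c i ∈ M) ∧
    LinearIndependent ℤ c ∧ gramDet c = s ^ d}
  have hroot : ∀ (d : ℕ) (c : Fin d → F), 0 < d → (∀ i, c i ∈ M) → LinearIndependent ℤ c →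
      gramDet c ^ ((d : ℝ)⁻¹) ∈ S := fun d c hd hc hci =>
    ⟨Real.rpow_nonneg (gramDet_nonneg c) _, d, c, hd, hc, hci,
      (Real.rpow_inv_natCast_pow (gramDet_nonneg c) hd.ne').symm⟩
  have hlb : ∀ s ∈ S, c₀ ≤ s := by
    rintro s ⟨hs, d, c, hd, hc, hci, h⟩
    have := hM d c hc hci
    rw [h] at this
    exact (pow_le_pow_iff_left₀ hc₀.le hs hd.ne').1 this
  have hbdd : BddBelow S := ⟨c₀, hlb⟩
  have hne : S.Nonempty := by
    have : Module.IsTorsionFree ℤ F := .trans_faithfulSMul ℤ ℝ F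
    exact ⟨_, hroot 1 (fun _ => x) one_pos (fun _ => hx)
      (LinearIndependent.of_subsingleton 0 hx0)⟩
  have ht : c₀ ≤ sInf S := le_csInf hne hlb
  have ht0 : 0 < sInf S := hc₀.trans_le ht
  refine ⟨sInf S, ht0, fun d c hc hci => ?_, fun δ hδ => ?_⟩
  · rcases Nat.eq_zero_or_pos d with rfl | hd
    · simp [gramDet_of_isEmpty]
    · have h1 := csInf_le hbdd (hroot d c hd hc hci)
      calc sInf S ^ d ≤ (gramDet c ^ ((d : ℝ)⁻¹)) ^ d := by gcongr
        _ = gramDet c := Real.rpow_inv_natCast_pow (gramDet_nonneg c) hd.ne'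
  · obtain ⟨s, ⟨hs0, d, c, hd, hc, hci, h⟩, hs⟩ := exists_lt_of_csInf_lt hne
      (show sInf S < δ * sInf S by nlinarith)
    exact ⟨d, c, hd, hc, hci, by rw [h]; gcongr⟩

/-- Families of the projected module lift to families of `M` extending `b`. -/
theorem exists_lift_of_map_orthProj [FiniteDimensional ℝ F] {M : Submodule ℤ F} {k d : ℕ}
    {b : Fin k → F} (hb : LinearIndependent ℝ b) (hbM : ∀ i, b i ∈ M) {c : Fin d → F}
    (hc : ∀ i, c i ∈ M.map (orthProj (Submodule.span ℝ (Set.range b))))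
    (hci : LinearIndependent ℤ c) :
    ∃ c' : Fin (k + d) → F, (∀ i, c' i ∈ M) ∧ LinearIndependent ℤ c' ∧
      gramDet c' = gramDet b * gramDet c := by
  set V := Submodule.span ℝ (Set.range b)
  choose v hvM hv using hc
  have hli : LinearIndependent ℤ (Sum.elim b v) := by
    rw [Fintype.linearIndependent_iff]
    intro g hg
    rw [Fintype.sum_sum_type] at hg
    simp only [Sum.elim_inl, Sum.elim_inr] at hg
    have h1 := congrArg (orthProj V) hg
    rw [map_add, map_sum, map_sum, map_zero, Finset.sum_eq_zero, zero_add] at h1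
    · simp only [map_zsmul, hv] at h1
      have h2 := Fintype.linearIndependent_iff.1 hci _ h1
      simp only [h2, zero_smul, Finset.sum_const_zero, add_zero] at hg
      have h3 := Fintype.linearIndependent_iff.1 (linearIndependent_int_of_real hb) _ hg
      rintro (i | i)
      · exact h3 i
      · exact h2 i
    · intro i _
      rw [map_zsmul, orthProj_apply, orthProj_eq_zero_iff.2, smul_zero]
      exact Submodule.subset_span (Set.mem_range_self i)
  refine ⟨Sum.elim b v ∘ finSumFinEquiv.symm, fun i => ?_, hli.comp _ (Equiv.injective _), ?_⟩
  · rw [Function.comp_apply]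
    rcases finSumFinEquiv.symm i with j | j
    · exact hbM j
    · exact hvM j
  · rw [gramDet_reindex, gramDet_sumElim]
    congr 2
    ext j
    exact hv j

end

/-! ### Scaling along an approximate canonical filtration. -/

section

variable {F : Type*} [NormedAddCommGroup F] [InnerProductSpace ℝ F]

theorem diagMap_comp_equiv {ι κ : Type*} [Fintype ι] [Fintype κ] (σ : κ ≃ ι) (e : ι → F)
    (a : ι → ℝ) (x : F) : diagMap (e ∘ σ) (a ∘ σ) x = diagMap e a x := by
  rw [diagMap_apply, diagMap_apply]
  exact Equiv.sum_comp σ fun i => (inner ℝ (e i) x * a i) • e i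

theorem diagMap_sumElim {ι κ : Type*} [Fintype ι] [Fintype κ] (e : ι → F) (f : κ → F)
    (a : ι → ℝ) (b : κ → ℝ) (x : F) :
    diagMap (Sum.elim e f) (Sum.elim a b) x = diagMap e a x + diagMap f b x := by
  simp [diagMap_apply]

theorem diagMap_const {ι : Type*} [Fintype ι] {V : Submodule ℝ F} [V.HasOrthogonalProjection]
    (f : OrthonormalBasis ι ℝ V) (α : ℝ) (x : F) :
    diagMap (fun i => (f i : F)) (fun _ => α) x = α • V.starProjection x := by
  rw [diagMap_apply, f.starProjection_eq_sum_rankOne]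
  simp [Finset.smul_sum, smul_smul, mul_comm]

theorem diagMap_mem_span {ι : Type*} [Fintype ι] (e : ι → F) (a : ι → ℝ) (x : F) :
    diagMap e a x ∈ Submodule.span ℝ (Set.range e) := by
  rw [diagMap_apply]
  exact sum_mem fun i _ => Submodule.smul_mem _ _ (Submodule.subset_span (Set.mem_range_self i))

variable [FiniteDimensional ℝ F]

/-- One step of the filtration: a scaling of `M` is obtained from a scaling of its projection
orthogonally to `V`. -/
theorem GramDetGeOne.of_scaling_map_orthProj {M : Submodule ℤ F} {V : Submodule ℝ F} {t : ℝ}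
    (ht : 0 < t)
    (hM : ∀ (d : ℕ) (c : Fin d → F), (∀ i, c i ∈ M) → LinearIndependent ℤ c → t ^ d ≤ gramDet c)
    {m : ℕ} {e : Fin m → F} {a : Fin m → ℝ} (he : Orthonormal ℝ e) (ha : ∀ i, a i ≠ 0)
    (hspan : Submodule.span ℝ (Set.range e) =
      Submodule.span ℝ (M.map (orthProj V) : Set F))
    (hgood : GramDetGeOne ((M.map (orthProj V)).map ((diagMap e a).restrictScalars ℤ)))
    {A : F →ₗ[ℝ] F} (hA : ∀ x, A x = (√t)⁻¹ • V.starProjection x + diagMap e a x) :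
    GramDetGeOne (M.map (A.restrictScalars ℤ)) := by
  have heV : Submodule.span ℝ (Set.range e) ≤ Vᗮ := by
    rw [hspan, Submodule.span_le]
    rintro _ ⟨x, _, rfl⟩
    exact Vᗮ.starProjection_apply_mem x
  have hD : ∀ x, Vᗮ.starProjection (diagMap e a x) = diagMap e a x := fun x =>
    Submodule.starProjection_eq_self_iff.2 (heV (diagMap_mem_span e a x))
  have hDV : ∀ x ∈ V, diagMap e a x = 0 := fun x hx => by
    rw [diagMap_apply]
    refine Finset.sum_eq_zero fun i _ => ?_
    rw [Submodule.inner_left_of_mem_orthogonal hx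
      (heV (Submodule.subset_span (Set.mem_range_self i))), zero_mul, zero_smul]
  have hDπ : ∀ x, diagMap e a (Vᗮ.starProjection x) = diagMap e a x := fun x => by
    conv_rhs => rw [← V.starProjection_add_starProjection_orthogonal x, map_add,
      hDV _ (V.starProjection_apply_mem x), zero_add]
  have hπA : ∀ x, Vᗮ.starProjection (A x) = diagMap e a x := fun x => by
    rw [hA, map_add, hD, map_smul, orthProj_eq_zero_iff.2 (V.starProjection_apply_mem x),
      smul_zero, zero_add]
  refine GramDetGeOne.of_inf_of_map V ?_ (hgood.mono ?_)
  -- The part inside V: since the scaling is injective on the projection of M, a vector of A(M) in V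
  -- comes from a vector of M in V, on which A is division by √t. The slope bound for M then gives
  -- exactly 1.
  · intro d c hc hci
    choose x hxM hx using fun i => (hc i).1
    have hxc : ∀ i, A (x i) = c i := hx
    have hxV : ∀ i, x i ∈ V := fun i => by
      have h1 : diagMap e a (Vᗮ.starProjection (x i)) = 0 := by
        rw [hDπ, ← hπA, hxc, orthProj_eq_zero_iff]
        exact (hc i).2
      refine orthProj_eq_zero_iff.1 (eq_zero_of_diagMap_eq_zero he ha ?_ h1)
      rw [hspan]
      exact Submodule.subset_span ⟨x i, hxM i, rfl⟩
    have hc2 : c = fun i => (√t)⁻¹ • x i := by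
      ext1 i
      rw [← hxc, hA, hDV _ (hxV i), add_zero, Submodule.starProjection_eq_self_iff.2 (hxV i)]
    have hxi : LinearIndependent ℤ x := by
      refine LinearIndependent.of_comp (A.restrictScalars ℤ) ?_
      convert hci using 1
      ext1 i
      exact hxc i
    rw [hc2, gramDet_smul, inv_pow, Real.sq_sqrt ht.le, Fintype.card_fin, inv_pow,
      inv_mul_eq_div, one_le_div (pow_pos ht d)]
    exact hM d x hxM hxi
  · rintro _ ⟨_, ⟨x, hx, rfl⟩, rfl⟩
    refine ⟨orthProj V x, ⟨x, hx, rfl⟩, ?_⟩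
    change diagMap e a (Vᗮ.starProjection x) = Vᗮ.starProjection (A x)
    rw [hDπ, hπA]

/-- The span of `M` is the orthogonal sum of `V` and the span of the projection of `M`. -/
theorem span_eq_sup_span_map_orthProj {M : Submodule ℤ F} {V : Submodule ℝ F}
    (hV : V ≤ Submodule.span ℝ (M : Set F)) :
    Submodule.span ℝ (M : Set F) = V ⊔ Submodule.span ℝ (M.map (orthProj V) : Set F) := by
  apply le_antisymm
  · rw [Submodule.span_le]
    intro x hx
    rw [← V.starProjection_add_starProjection_orthogonal x]
    exact Submodule.add_mem_sup (V.starProjection_apply_mem x)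
      (Submodule.subset_span ⟨x, hx, rfl⟩)
  · refine sup_le hV (Submodule.span_le.2 ?_)
    rintro _ ⟨x, hx, rfl⟩
    have h := V.starProjection_add_starProjection_orthogonal x
    have : Vᗮ.starProjection x = x - V.starProjection x := by rw [← h]; simp
    rw [orthProj_apply, this]
    exact sub_mem (Submodule.subset_span hx) (hV (V.starProjection_apply_mem x))

/-- The induction is on the rank: a nearly optimal family b spans V, and the projection of M onto Vᗮ
is treated recursively. The hypothesis on c₀ replaces discreteness and keeps the slopes positive.
The family attached to j generates the filtration step containing the index j, up to the
approximation θ, so it has more than j members. -/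
theorem exists_scaling (n : ℕ) : ∀ (M : Submodule ℤ F),
    Module.finrank ℝ (Submodule.span ℝ (M : Set F)) = n → ∀ c₀ : ℝ, 0 < c₀ →
    (∀ (d : ℕ) (c : Fin d → F), (∀ i, c i ∈ M) → LinearIndependent ℤ c → c₀ ^ d ≤ gramDet c) →
    ∀ θ : ℝ, 1 < θ → ∃ (e : Fin n → F) (t : Fin n → ℝ), Orthonormal ℝ e ∧
      Submodule.span ℝ (Set.range e) = Submodule.span ℝ (M : Set F) ∧ (∀ i, 0 < t i) ∧
      GramDetGeOne (M.map ((diagMap e fun i => (√(t i))⁻¹).restrictScalars ℤ)) ∧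
      ∀ j : Fin n, ∃ (d : ℕ) (c : Fin d → F), (j : ℕ) < d ∧ (∀ i, c i ∈ M) ∧
        LinearIndependent ℤ c ∧ gramDet c ≤ (θ * t j) ^ d := by
  induction n using Nat.strong_induction_on with
  | _ n ih =>
  intro M hMn c₀ hc₀ hM θ hθ
  rcases Nat.eq_zero_or_pos n with rfl | hn
  · refine ⟨Fin.elim0, Fin.elim0, ⟨fun i => i.elim0, fun i => i.elim0⟩, ?_, fun i => i.elim0, ?_,
      fun i => i.elim0⟩
    · rw [Submodule.finrank_eq_zero.1 hMn]
      simp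
    · intro d c hc hci
      rcases Nat.eq_zero_or_pos d with rfl | hd
      · rw [gramDet_of_isEmpty]
      · obtain ⟨x, _, hx⟩ := hc ⟨0, hd⟩
        refine absurd hx.symm ?_
        have : diagMap (Fin.elim0 : Fin 0 → F)
            (fun i => (√((Fin.elim0 : Fin 0 → ℝ) i))⁻¹) x = 0 := by
          simp [diagMap_apply]
        rw [LinearMap.restrictScalars_apply, this]
        exact hci.ne_zero _
  obtain ⟨x, hxM, hx0⟩ : ∃ x ∈ M, x ≠ 0 := by
    by_contra! h
    have : Submodule.span ℝ (M : Set F) = ⊥ := by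
      rw [Submodule.span_eq_bot]; exact h
    rw [this, finrank_bot] at hMn
    omega
  obtain ⟨t, ht, htM, happrox⟩ := exists_optimal_slope hc₀ hM hxM hx0
  -- Error budget: θ = θ'², one factor θ' for the recursive call and one for this step, where δ =
  -- θ'^(1/(n+1)) is lost at most k + 1 ≤ n + 1 times.
  set θ' := √θ
  have hθ0 : 0 < θ := by linarith
  have hθ' : 1 < θ' := by
    rw [Real.lt_sqrt zero_le_one]; simpa using hθ
  have hθθ : θ' * θ' = θ := Real.mul_self_sqrt hθ0.le
  set δ := θ' ^ (((n + 1 : ℕ) : ℝ)⁻¹)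
  have hδn : δ ^ (n + 1) = θ' := Real.rpow_inv_natCast_pow (by linarith) (by omega)
  have hδ : 1 < δ := Real.one_lt_rpow hθ' (by positivity)
  have hδ0 : 0 < δ := by linarith
  obtain ⟨k, b, hk, hbM, hbi, hbt⟩ := happrox δ hδ
  have hbpos : 0 < gramDet b := (pow_pos ht k).trans_le (htM k b hbM hbi)
  have hb : LinearIndependent ℝ b := gramDet_ne_zero_iff.1 hbpos.ne'
  set V := Submodule.span ℝ (Set.range b) with hVdef
  have hVk : Module.finrank ℝ V = k := by
    rw [finrank_span_eq_card hb, Fintype.card_fin]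
  have hVM : V ≤ Submodule.span ℝ (M : Set F) :=
    Submodule.span_mono (by rintro _ ⟨i, rfl⟩; exact hbM i)
  have hsup := span_eq_sup_span_map_orthProj hVM
  set U := Submodule.span ℝ (M.map (orthProj V) : Set F) with hU
  have hUV : U ≤ Vᗮ := by
    rw [hU, Submodule.span_le]
    rintro _ ⟨x, _, rfl⟩
    exact Vᗮ.starProjection_apply_mem x
  set m := Module.finrank ℝ U with hm
  have hkm : k + m = n := by
    have h1 := Submodule.finrank_sup_add_finrank_inf_eq V U
    have h2 : V ⊓ U = ⊥ := by
      rw [eq_bot_iff]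
      refine le_trans (inf_le_inf_left V hUV) ?_
      rw [Submodule.inf_orthogonal_eq_bot]
    rw [h2, finrank_bot, ← hsup] at h1
    omega
  have hδk : 1 ≤ δ ^ k := one_le_pow₀ hδ.le
  -- Near-minimality of b bounds the slopes of the projection: a family c there lifts to one of size
  -- k + d containing b, whose volume is at least t^(k+d), while b accounts for at most (δt)^k.
  have hprojlb : ∀ (d : ℕ) (c : Fin d → F), (∀ i, c i ∈ M.map (orthProj V)) →
      LinearIndependent ℤ c → t ^ d ≤ δ ^ k * gramDet c := by
    intro d c hc hci
    obtain ⟨c', hc'M, hc'i, hc'⟩ := exists_lift_of_map_orthProj hb hbM hc hci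
    have h1 := htM _ c' hc'M hc'i
    rw [hc'] at h1
    have h2 : t ^ k * t ^ d ≤ t ^ k * (δ ^ k * gramDet c) := by
      calc t ^ k * t ^ d ≤ gramDet b * gramDet c := by rw [← pow_add]; exact h1
        _ ≤ (δ * t) ^ k * gramDet c := mul_le_mul_of_nonneg_right hbt (gramDet_nonneg c)
        _ = _ := by rw [mul_pow]; ring
    exact le_of_mul_le_mul_left h2 (pow_pos ht k)
  -- The recursive call needs a pure d-th power as lower bound; t / δ^k gives one, since δ^k ≤
  -- (δ^k)^d for d ≥ 1.
  obtain ⟨e', t', he', hspan', ht', hgood', hfam'⟩ := ih m (by omega) (M.map (orthProj V)) rfl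
    (t / δ ^ k) (by positivity) (fun d c hc hci => by
      rcases Nat.eq_zero_or_pos d with rfl | hd
      · simp [gramDet_of_isEmpty]
      · have h1 := hprojlb d c hc hci
        rw [div_pow, div_le_iff₀ (by positivity), mul_comm]
        refine h1.trans (mul_le_mul_of_nonneg_right ?_ (gramDet_nonneg c))
        exact le_self_pow₀ hδk hd.ne') θ' hθ'
  have hδθ : δ ^ k * (δ * θ') ≤ θ := by
    calc δ ^ k * (δ * θ') = δ ^ (k + 1) * θ' := by ring
      _ ≤ δ ^ (n + 1) * θ' := by
        have : k + 1 ≤ n + 1 := by omega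
        gcongr
        exact hδ.le
      _ = θ := by rw [hδn, hθθ]
  let f : OrthonormalBasis (Fin k) ℝ V := (stdOrthonormalBasis ℝ V).reindex (finCongr hVk)
  let σ : Fin n ≃ Fin k ⊕ Fin m := (finCongr hkm.symm).trans finSumFinEquiv.symm
  let eS : Fin k ⊕ Fin m → F := Sum.elim (fun i => (f i : F)) e'
  let tS : Fin k ⊕ Fin m → ℝ := Sum.elim (fun _ => t) t'
  have hfspan : Submodule.span ℝ (Set.range fun i => (f i : F)) = V := by
    have h1 := congrArg (Submodule.map V.subtype) f.toBasis.span_eq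
    rw [Submodule.map_span, ← Set.range_comp, Submodule.map_subtype_top] at h1
    simpa [Function.comp_def] using h1
  refine ⟨eS ∘ σ, tS ∘ σ, ?_, ?_, ?_, ?_, ?_⟩
  · refine Orthonormal.comp (orthonormal_sumElim
      (f.orthonormal.comp_linearIsometry V.subtypeₗᵢ) he' fun i j => ?_) _ σ.injective
    exact Submodule.inner_right_of_mem_orthogonal (f i).2
      (hUV (hspan'.le (Submodule.subset_span (Set.mem_range_self j))))
  · rw [Set.range_comp, σ.surjective.range_eq, Set.image_univ, Set.Sum.elim_range,
      Submodule.span_union, hfspan, hspan', hsup]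
  · intro i
    rw [Function.comp_apply]
    rcases σ i with j | j
    · exact ht
    · exact ht' j
  · refine GramDetGeOne.of_scaling_map_orthProj ht htM he'
      (fun i => (inv_pos.2 (Real.sqrt_pos.2 (ht' i))).ne') hspan' hgood' fun x => ?_
    have h1 : (fun i => (√((tS ∘ σ) i))⁻¹) =
        Sum.elim (fun _ => (√t)⁻¹) (fun i => (√(t' i))⁻¹) ∘ σ := by
      ext1 i
      rw [Function.comp_apply, Function.comp_apply]
      rcases σ i with j | j <;> rfl
    rw [h1, diagMap_comp_equiv, diagMap_sumElim, diagMap_const]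
  · intro j
    obtain ⟨j', rfl⟩ := σ.symm.surjective j
    rw [Function.comp_apply, Equiv.apply_symm_apply]
    have hθδ : δ ≤ θ := by
      nlinarith [mul_le_mul hδk (le_refl (δ * θ')) (by positivity) (by positivity)]
    rcases j' with j' | j'
    · refine ⟨k, b, by simp [σ], hbM, hbi, hbt.trans ?_⟩
      change (δ * t) ^ k ≤ (θ * t) ^ k
      gcongr
    · obtain ⟨d, c, hjd, hc, hci, hct⟩ := hfam' j'
      obtain ⟨c', hc'M, hc'i, hc'⟩ := exists_lift_of_map_orthProj hb hbM hc hci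
      refine ⟨k + d, c', by simp [σ]; omega, hc'M, hc'i, ?_⟩
      change gramDet c' ≤ (θ * t' j') ^ (k + d)
      have hs := ht' j'
      set s := t' j'
      have hd : d ≠ 0 := by omega
      -- Later slopes are at least t up to the error, so joining b to the lifted family keeps the
      -- slope below θ s.
      have h1 : t ≤ δ ^ k * θ' * s := by
        refine (pow_le_pow_iff_left₀ ht.le (by positivity) hd).1 ?_
        calc t ^ d ≤ δ ^ k * gramDet c := hprojlb d c hc hci
          _ ≤ δ ^ k * (θ' * s) ^ d := by gcongr
          _ ≤ (δ ^ k) ^ d * (θ' * s) ^ d := by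
            gcongr
            exact le_self_pow₀ hδk hd
          _ = _ := by rw [← mul_pow, mul_assoc]
      have h2 : δ * t ≤ θ * s := by
        calc δ * t ≤ δ * (δ ^ k * θ' * s) := by gcongr
          _ = δ ^ k * (δ * θ') * s := by ring
          _ ≤ θ * s := by gcongr
      have h3 : θ' ≤ θ := by nlinarith
      rw [hc', pow_add]
      refine mul_le_mul (hbt.trans (by gcongr)) (hct.trans (by gcongr)) (gramDet_nonneg c)
        (by positivity)

end

/-! ### Dual bases and slices of the dual lattice. -/

section

section dualBasis

variable {F : Type*} [NormedAddCommGroup F] [InnerProductSpace ℝ F]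

theorem eq_zero_of_mem_span_of_inner_eq_zero {ι : Type*} {b : ι → F} {x : F}
    (hx : x ∈ Submodule.span ℝ (Set.range b)) (h : ∀ i, inner ℝ x (b i) = 0) : x = 0 := by
  have h1 : ∀ y ∈ Submodule.span ℝ (Set.range b), inner ℝ x y = 0 := fun y hy => by
    induction hy using Submodule.span_induction with
    | mem y hy => obtain ⟨i, rfl⟩ := hy; exact h i
    | zero => simp
    | add y z _ _ hy hz => rw [inner_add_right, hy, hz, add_zero]
    | smul r y _ hy => rw [real_inner_smul_right, hy, mul_zero]
  exact inner_self_eq_zero.1 (h1 x hx)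

/-- A linearly independent family has a dual family with the same span. -/
theorem exists_dual_family {ι : Type*} [Fintype ι] [DecidableEq ι] {b : ι → F}
    (hb : LinearIndependent ℝ b) : ∃ m : ι → F,
      (∀ i j, inner ℝ (m i) (b j) = if i = j then (1 : ℝ) else 0) ∧
      (∀ i, m i ∈ Submodule.span ℝ (Set.range b)) := by
  have hG : IsUnit (Matrix.gram ℝ b).det := (gramDet_pos hb).ne'.isUnit
  refine ⟨fun i => ∑ k, (Matrix.gram ℝ b)⁻¹ i k • b k, fun i j => ?_, fun i =>
    sum_mem fun k _ => Submodule.smul_mem _ _ (Submodule.subset_span (Set.mem_range_self k))⟩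
  have h := congrFun (congrFun (Matrix.nonsing_inv_mul _ hG) i) j
  rw [Matrix.mul_apply, Matrix.one_apply] at h
  rw [← h, sum_inner]
  simp [real_inner_smul_left, Matrix.gram_apply]

theorem eq_sum_inner_smul_of_dual {ι : Type*} [Fintype ι] [DecidableEq ι] {b m : ι → F}
    (h : ∀ i j, inner ℝ (m i) (b j) = if i = j then (1 : ℝ) else 0)
    (hm : ∀ i, m i ∈ Submodule.span ℝ (Set.range b)) {x : F}
    (hx : x ∈ Submodule.span ℝ (Set.range b)) : x = ∑ i, (inner ℝ x (b i) : ℝ) • m i := by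
  rw [← sub_eq_zero]
  refine eq_zero_of_mem_span_of_inner_eq_zero
    (sub_mem hx (sum_mem fun i _ => Submodule.smul_mem _ _ (hm i))) fun j => ?_
  rw [inner_sub_left, sum_inner]
  simp [real_inner_smul_left, h]

theorem linearIndependent_of_dual {ι : Type*} [Fintype ι] [DecidableEq ι] {b m : ι → F}
    (h : ∀ i j, inner ℝ (m i) (b j) = if i = j then (1 : ℝ) else 0) : LinearIndependent ℝ m := by
  rw [Fintype.linearIndependent_iff]
  intro g hg j
  have h1 := congrArg (fun x => inner ℝ x (b j)) hg
  simpa [sum_inner, real_inner_smul_left, h] using h1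

end dualBasis

variable {n d : ℕ} {L : Submodule ℤ (E n)} {l : Fin d → E n}

theorem IsBasisOf.span_real (hl : IsBasisOf l L) :
    Submodule.span ℝ (L : Set (E n)) = Submodule.span ℝ (Set.range l) := by
  rw [← hl.2]
  exact Submodule.span_span_of_tower ℤ ℝ _

theorem IsBasisOf.mem (hl : IsBasisOf l L) (i : Fin d) : l i ∈ L := by
  rw [← hl.2]; exact Submodule.subset_span (Set.mem_range_self i)

theorem IsBasisOf.mem_iff (hl : IsBasisOf l L) {x : E n} :
    x ∈ L ↔ ∃ z : Fin d → ℤ, ∑ i, z i • l i = x := by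
  rw [← hl.2, Submodule.mem_span_range_iff_exists_fun]

theorem IsBasisOf.mem_dual_iff (hl : IsBasisOf l L) {y : E n} :
    y ∈ dual L ↔ y ∈ Submodule.span ℝ (Set.range l) ∧ ∀ i, ∃ k : ℤ, inner ℝ y (l i) = (k : ℝ) := by
  constructor
  · rintro ⟨h1, h2⟩
    exact ⟨hl.span_real ▸ h1, fun i => h2 _ (hl.mem i)⟩
  · rintro ⟨h1, h2⟩
    refine ⟨hl.span_real ▸ h1, fun x hx => ?_⟩
    obtain ⟨z, rfl⟩ := hl.mem_iff.1 hx
    choose k hk using h2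
    refine ⟨∑ i, z i * k i, ?_⟩
    rw [inner_sum]
    push_cast
    refine Finset.sum_congr rfl fun i _ => ?_
    rw [← Int.cast_smul_eq_zsmul ℝ, real_inner_smul_right, hk]

/-- The dual basis is a basis of the dual lattice, and it determines the lattice. -/
theorem IsBasisOf.exists_dual (hl : IsBasisOf l L) : ∃ m : Fin d → E n, IsBasisOf m (dual L) ∧
    Submodule.span ℝ (Set.range m) = Submodule.span ℝ (Set.range l) ∧
    ∀ y ∈ Submodule.span ℝ (Set.range l), (∀ i, ∃ k : ℤ, inner ℝ y (m i) = (k : ℝ)) → y ∈ L := by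
  obtain ⟨m, hml, hm⟩ := exists_dual_family hl.1
  have hmi := linearIndependent_of_dual hml
  have hspan : Submodule.span ℝ (Set.range m) = Submodule.span ℝ (Set.range l) := by
    refine le_antisymm (Submodule.span_le.2 (by rintro _ ⟨i, rfl⟩; exact hm i)) fun x hx => ?_
    rw [eq_sum_inner_smul_of_dual hml hm hx]
    exact sum_mem fun i _ => Submodule.smul_mem _ _ (Submodule.subset_span (Set.mem_range_self i))
  refine ⟨m, ⟨hmi, ?_⟩, hspan, fun y hy h => ?_⟩
  · ext y
    rw [Submodule.mem_span_range_iff_exists_fun, hl.mem_dual_iff]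
    constructor
    · rintro ⟨z, rfl⟩
      refine ⟨sum_mem fun i _ => zsmul_mem (hm i) _, fun j => ⟨z j, ?_⟩⟩
      rw [sum_inner]
      simp [← Int.cast_smul_eq_zsmul ℝ, real_inner_smul_left, hml]
    · rintro ⟨h1, h2⟩
      choose k hk using h2
      refine ⟨k, ?_⟩
      conv_rhs => rw [eq_sum_inner_smul_of_dual hml hm h1]
      exact Finset.sum_congr rfl fun i _ => by rw [hk, Int.cast_smul_eq_zsmul]
  · have hlm : ∀ i j, inner ℝ (l i) (m j) = if i = j then (1 : ℝ) else 0 := fun i j => by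
      rw [real_inner_comm, hml]
      simp [eq_comm]
    have hlspan : ∀ i, l i ∈ Submodule.span ℝ (Set.range m) := fun i => by
      rw [hspan]; exact Submodule.subset_span (Set.mem_range_self i)
    choose k hk using h
    rw [eq_sum_inner_smul_of_dual hlm hlspan (x := y) (by rw [hspan]; exact hy)]
    refine sum_mem fun i _ => ?_
    rw [hk, Int.cast_smul_eq_zsmul]
    exact zsmul_mem (hl.mem i) _

/-- `ℤ`-independent families of the dual lattice are `ℝ`-independent, and their Gram determinants
are bounded below. -/
theorem IsBasisOf.exists_pow_le_gramDet (hl : IsBasisOf l L) : ∃ c₀ : ℝ, 0 < c₀ ∧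
    ∀ (e : ℕ) (c : Fin e → E n), (∀ i, c i ∈ dual L) → LinearIndependent ℤ c →
      LinearIndependent ℝ c ∧ c₀ ^ e ≤ gramDet c := by
  -- Inner products with the basis l embed L* in ℤ^d, where Gram determinants are at least 1, and T
  -- changes volumes by a bounded factor.
  let T : E n →ₗ[ℝ] E d :=
    (WithLp.linearEquiv 2 ℝ (Fin d → ℝ)).symm.toLinearMap ∘ₗ
      LinearMap.pi fun i => innerₛₗ ℝ (l i)
  have hT : ∀ x i, T x i = inner ℝ (l i) x := fun x i => rfl
  set S := ∑ k, ‖T (EuclideanSpace.basisFun (Fin n) ℝ k)‖ ^ 2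
  have hS : 0 ≤ S := Finset.sum_nonneg fun _ _ => sq_nonneg _
  -- S + 1 instead of S, which vanishes for the zero lattice.
  refine ⟨(S + 1)⁻¹, by positivity, fun e c hc hci => ?_⟩
  have hTc : ∀ i k, ∃ z : ℤ, T (c i) k = z := fun i k => by
    obtain ⟨z, hz⟩ := (hl.mem_dual_iff.1 (hc i)).2 k
    exact ⟨z, by rw [hT, real_inner_comm, hz]⟩
  have hTi : LinearIndependent ℤ (fun i => T (c i)) := by
    rw [Fintype.linearIndependent_iff] at hci ⊢
    intro g hg
    refine hci g ?_
    have h1 : ∑ i, g i • c i ∈ Submodule.span ℝ (Set.range l) :=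
      sum_mem fun i _ => zsmul_mem (hl.mem_dual_iff.1 (hc i)).1 _
    have h2 : T (∑ i, g i • c i) = 0 := by
      rw [← hg, map_sum]
      simp
    refine eq_zero_of_mem_span_of_inner_eq_zero h1 fun i => ?_
    rw [real_inner_comm, ← hT, h2]
    rfl
  obtain ⟨h1, h2⟩ := linearIndependent_and_one_le_gramDet_of_int hTc hTi
  refine ⟨LinearIndependent.of_comp T h1, ?_⟩
  rcases Nat.eq_zero_or_pos e with rfl | he
  · simp [gramDet_of_isEmpty]
  have : Nonempty (Fin e) := ⟨⟨0, he⟩⟩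
  have h3 := h2.trans (gramDet_map_le_pow_mul T (EuclideanSpace.basisFun (Fin n) ℝ) c)
  rw [Fintype.card_fin] at h3
  have h4 : S / e ≤ S + 1 := by
    rw [div_le_iff₀ (by exact_mod_cast he)]
    have : (1 : ℝ) ≤ e := by exact_mod_cast he
    nlinarith
  have h5 : 1 ≤ (S + 1) ^ e * gramDet c :=
    h3.trans (mul_le_mul_of_nonneg_right (by gcongr) (gramDet_nonneg c))
  rw [inv_pow, inv_le_iff_one_le_mul₀ (by positivity), mul_comm]
  exact h5

/-- A subgroup of a finitely generated torsion-free group has a ℤ-basis; the real independence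
demanded by `IsBasisOf` comes from `IsBasisOf.exists_pow_le_gramDet`. -/
theorem IsBasisOf.exists_basis_of_le_dual (hl : IsBasisOf l L) {N : Submodule ℤ (E n)}
    (hN : N ≤ dual L) : ∃ (e : ℕ) (u : Fin e → E n), IsBasisOf u N := by
  obtain ⟨m, hm, -, -⟩ := hl.exists_dual
  have : Module.Finite ℤ (dual L) := by
    rw [← hm.2]; exact Module.Finite.span_of_finite ℤ (Set.finite_range m)
  have : Module.Free ℤ N := by
    have : Module.IsTorsionFree ℤ (E n) := .trans_faithfulSMul ℤ ℝ _
    have : Module.Finite ℤ N :=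
      Module.Finite.of_injective (Submodule.inclusion hN) (Submodule.inclusion_injective hN)
    exact Module.free_of_finite_type_torsion_free'
  have : Module.Finite ℤ N :=
    Module.Finite.of_injective (Submodule.inclusion hN) (Submodule.inclusion_injective hN)
  let B := Module.finBasis ℤ N
  obtain ⟨c₀, -, h⟩ := hl.exists_pow_le_gramDet
  refine ⟨_, fun i => (B i : E n), (h _ _ (fun i => hN (B i).2) ?_).1, ?_⟩
  · exact B.linearIndependent.map' N.subtype (Submodule.ker_subtype N)
  · have h1 := congrArg (Submodule.map N.subtype) B.span_eq
    rw [Submodule.map_span, ← Set.range_comp, Submodule.map_subtype_top] at h1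
    exact h1

theorem IsBasisOf.exists_basis_slice (hl : IsBasisOf l L) {W : Submodule ℝ (E n)}
    (hW : IsLatticeSubspace (dual L) W) :
    ∃ u : Fin (Module.finrank ℝ W) → E n, IsBasisOf u (slice (dual L) W) := by
  obtain ⟨e, u, hu⟩ := hl.exists_basis_of_le_dual (N := slice (dual L) W) inf_le_left
  obtain ⟨w, hw⟩ := hW
  have huW : Submodule.span ℝ (Set.range u) = W := by
    apply le_antisymm
    · rw [Submodule.span_le]
      rintro _ ⟨i, rfl⟩
      exact (hu.mem i).2
    · rw [← hu.span_real]
      have h1 := congrArg (Submodule.map W.subtype) w.span_eq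
      rw [Submodule.map_span, ← Set.range_comp, Submodule.map_subtype_top] at h1
      refine h1.symm.le.trans (Submodule.span_mono ?_)
      rintro _ ⟨i, rfl⟩
      exact ⟨hw i, (w i).2⟩
  have he : Module.finrank ℝ W = e := by
    rw [← huW, finrank_span_eq_card hu.1, Fintype.card_fin]
  rw [he]
  exact ⟨u, hu⟩

theorem gramVol_eq_sqrt {d : ℕ} (b : Fin d → E n) : gramVol b = √(gramDet b) := rfl

/-- The determinant of the slice by the span of a family is at most the volume of the family. -/
theorem IsBasisOf.latticeDet_slice_le (hl : IsBasisOf l L) {e : ℕ} {c : Fin e → E n}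
    (hc : ∀ i, c i ∈ dual L) (hci : LinearIndependent ℝ c) :
    IsLatticeSubspace (dual L) (Submodule.span ℝ (Set.range c)) ∧
    Module.finrank ℝ (Submodule.span ℝ (Set.range c)) = e ∧
    0 < latticeDet (slice (dual L) (Submodule.span ℝ (Set.range c))) ∧
    latticeDet (slice (dual L) (Submodule.span ℝ (Set.range c))) ≤ √(gramDet c) := by
  set W := Submodule.span ℝ (Set.range c) with hWdef
  have hWe : Module.finrank ℝ W = e := by
    rw [finrank_span_eq_card hci, Fintype.card_fin]
  have hW : IsLatticeSubspace (dual L) W := by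
    refine ⟨(Module.Basis.span hci).reindex (finCongr hWe.symm), fun i => ?_⟩
    rw [Module.Basis.reindex_apply]
    have := congrArg Subtype.val (Module.Basis.span_apply hci ((finCongr hWe.symm).symm i))
    rw [this]
    exact hc _
  refine ⟨hW, hWe, ?_⟩
  obtain ⟨u, hu⟩ := hl.exists_basis_slice hW
  rw [latticeDet_eq hu, gramVol_eq_sqrt]
  refine ⟨Real.sqrt_pos.2 (gramDet_pos hu.1), Real.sqrt_le_sqrt ?_⟩
  have hcs : ∀ j, c j ∈ slice (dual L) W := fun j =>
    ⟨hc j, Submodule.subset_span (Set.mem_range_self j)⟩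
  choose z hz using fun j => hu.mem_iff.1 (hcs j)
  let σ := finCongr hWe
  let P : Matrix (Fin (Module.finrank ℝ W)) (Fin (Module.finrank ℝ W)) ℤ :=
    Matrix.of fun i j => z (σ j) i
  have hP : ∀ j, (c ∘ σ) j = ∑ i, (P.map (Int.castRingHom ℝ)) i j • u i := fun j => by
    rw [Function.comp_apply, ← hz]
    exact Finset.sum_congr rfl fun i _ => (Int.cast_smul_eq_zsmul ℝ _ _).symm
  have h1 := gramDet_sum_smul _ hP
  have h2 : (P.map (Int.castRingHom ℝ)).det = (P.det : ℝ) :=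
    ((Int.castRingHom ℝ).map_det P).symm
  rw [gramDet_reindex, h2] at h1
  -- P expresses c in a basis of the slice; its determinant is a nonzero integer (up to sign the
  -- index), so its square is at least 1.
  have h3 : P.det ≠ 0 := by
    intro h0
    rw [h0] at h1
    simp only [Int.cast_zero, ne_eq, OfNat.ofNat_ne_zero, not_false_eq_true, zero_pow,
      zero_mul] at h1
    exact (gramDet_pos hci).ne' h1
  have h4 : (1 : ℝ) ≤ (P.det : ℝ) ^ 2 := by
    have : 1 ≤ P.det ^ 2 := by
      have := sq_pos_of_ne_zero h3
      omega
    exact_mod_cast this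
  rw [h1]
  nlinarith [gramDet_nonneg u]

theorem rpow_neg_inv_le {t V : ℝ} (ht : 0 < t) {d : ℕ} (hd : 1 ≤ d) (h : t ^ d ≤ V) :
    V ^ (-(1 / (d : ℝ))) ≤ t⁻¹ := by
  have h0 : 0 < t ^ d := by positivity
  rw [Real.rpow_neg (h0.le.trans h), one_div]
  refine inv_anti₀ ht ?_
  calc t = (t ^ d) ^ ((d : ℝ)⁻¹) := (Real.pow_rpow_inv_natCast ht.le (by omega)).symm
    _ ≤ _ := by gcongr

theorem le_rpow_neg_inv {t V : ℝ} (ht : 0 ≤ t) (hV : 0 < V) {d : ℕ} (hd : 1 ≤ d)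
    (h : V ≤ t ^ d) : t⁻¹ ≤ V ^ (-(1 / (d : ℝ))) := by
  rw [Real.rpow_neg hV.le, one_div]
  refine inv_anti₀ (by positivity) ?_
  calc V ^ ((d : ℝ)⁻¹) ≤ (t ^ d) ^ ((d : ℝ)⁻¹) := by gcongr
    _ = t := Real.pow_rpow_inv_natCast ht (by omega)

theorem IsBasisOf.le_klBound (hl : IsBasisOf l L) {e : ℕ} (he : 1 ≤ e) {c : Fin e → E n}
    (hc : ∀ i, c i ∈ dual L) (hci : LinearIndependent ℝ c) {s : ℝ} (hs : 0 ≤ s)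
    (h : gramDet c ≤ s ^ e) : ENNReal.ofReal (√e * (√s)⁻¹) ≤ klBound L := by
  obtain ⟨hW, hWe, hpos, hle⟩ := hl.latticeDet_slice_le hc hci
  refine le_trans ?_ (le_iSup₂_of_le (Submodule.span ℝ (Set.range c)) hW
    (le_iSup_of_le (by rw [hWe]; exact he) le_rfl))
  rw [hWe]
  gcongr
  refine le_rpow_neg_inv (Real.sqrt_nonneg s) hpos he (hle.trans ?_)
  rw [Real.sqrt_le_iff]
  refine ⟨by positivity, h.trans_eq ?_⟩
  rw [← pow_mul, mul_comm, pow_mul, Real.sq_sqrt hs]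

theorem IsBasisOf.exists_slope_le (hl : IsBasisOf l L) : ∃ s : ℝ, 0 < s ∧
    ∀ W : Submodule ℝ (E n), IsLatticeSubspace (dual L) W → 1 ≤ Module.finrank ℝ W →
      latticeDet (slice (dual L) W) ^ (-(1 / (Module.finrank ℝ W : ℝ))) ≤ s := by
  obtain ⟨c₀, hc₀, h⟩ := hl.exists_pow_le_gramDet
  refine ⟨(√c₀)⁻¹, by positivity, fun W hW hW1 => ?_⟩
  obtain ⟨u, hu⟩ := hl.exists_basis_slice hW
  rw [latticeDet_eq hu, gramVol_eq_sqrt]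
  refine rpow_neg_inv_le (by positivity) hW1 (Real.le_sqrt_of_sq_le ?_)
  rw [← pow_mul, mul_comm, pow_mul, Real.sq_sqrt hc₀.le]
  exact (h _ u (fun i => (hu.mem i).1) (linearIndependent_int_of_real hu.1)).2

theorem IsLattice.etaDet_ne_top (hL : IsLattice L) : etaDet L ≠ ⊤ := by
  obtain ⟨d, l, hl⟩ := hL
  obtain ⟨s, -, hs⟩ := hl.exists_slope_le
  refine ne_top_of_le_ne_top (ENNReal.ofReal_ne_top (r := s)) ?_
  exact iSup_le fun W => iSup₂_le fun hW hW1 => ENNReal.ofReal_le_ofReal (hs W hW hW1)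

theorem IsLattice.klBound_ne_top (hL : IsLattice L) : klBound L ≠ ⊤ := by
  obtain ⟨d, l, hl⟩ := hL
  obtain ⟨s, hs0, hs⟩ := hl.exists_slope_le
  refine ne_top_of_le_ne_top (ENNReal.ofReal_ne_top (r := √n * s)) ?_
  refine iSup_le fun W => iSup₂_le fun hW hW1 => ENNReal.ofReal_le_ofReal ?_
  have h1 : Module.finrank ℝ W ≤ n := by
    simpa using Submodule.finrank_le W
  exact mul_le_mul (Real.sqrt_le_sqrt (by exact_mod_cast h1)) (hs W hW hW1)
    (Real.rpow_nonneg (by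
      obtain ⟨u, hu⟩ := hl.exists_basis_slice hW
      rw [latticeDet_eq hu]; exact Real.sqrt_nonneg _) _) (Real.sqrt_nonneg _)

end

/-! ### Attained constants and the inequality `detConst n ≤ klConst n`. -/

section

variable {n d : ℕ} {L : Submodule ℤ (E n)} {l : Fin d → E n}

/-- The linear map of a matrix on Euclidean space, with its inner product adjoint. -/
theorem inner_toEuclideanLin_transpose (R : Matrix (Fin n) (Fin n) ℝ) (x y : E n) :
    inner ℝ (Matrix.toEuclideanLin R.transpose x) y = inner ℝ x (Matrix.toEuclideanLin R y) := by
  have := Matrix.toEuclideanLin_conjTranspose_eq_adjoint R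
  rw [Matrix.conjTranspose_eq_transpose_of_trivial] at this
  rw [this, LinearMap.adjoint_inner_left]

theorem toEuclideanLin_injective {R : Matrix (Fin n) (Fin n) ℝ} (hR : R.det ≠ 0) :
    Function.Injective (Matrix.toEuclideanLin R) := by
  intro x y h
  have h1 : R.mulVec (WithLp.ofLp x) = R.mulVec (WithLp.ofLp y) := congrArg (WithLp.ofLp) h
  have h2 := Matrix.mulVec_injective_of_isUnit ((Matrix.isUnit_iff_isUnit_det R).2 hR.isUnit) h1
  exact (WithLp.ofLp_injective 2) h2

theorem sum_norm_sq_toEuclideanLin (R : Matrix (Fin n) (Fin n) ℝ) :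
    ∑ k, ‖Matrix.toEuclideanLin R (EuclideanSpace.basisFun (Fin n) ℝ k)‖ ^ 2 =
      (R.transpose * R).trace := by
  rw [Matrix.trace]
  refine Finset.sum_congr rfl fun k _ => ?_
  rw [EuclideanSpace.norm_sq_eq, Matrix.diag_apply, Matrix.mul_apply]
  refine Finset.sum_congr rfl fun i _ => ?_
  have : (Matrix.toEuclideanLin R (EuclideanSpace.basisFun (Fin n) ℝ k)) i = R i k := by
    simp [Matrix.toEuclideanLin, EuclideanSpace.basisFun_apply, Matrix.toLpLin_apply]
  rw [this, Real.norm_eq_abs, sq_abs, Matrix.transpose_apply, sq]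

theorem trace_transpose_mul_self_pos (hn : 1 ≤ n) {R : Matrix (Fin n) (Fin n) ℝ}
    (hR : R.det ≠ 0) : 0 < (R.transpose * R).trace := by
  rw [← sum_norm_sq_toEuclideanLin]
  refine Finset.sum_pos (fun k _ => ?_) ⟨⟨0, hn⟩, Finset.mem_univ _⟩
  have h : Matrix.toEuclideanLin R (EuclideanSpace.basisFun (Fin n) ℝ k) ≠ 0 := by
    rw [Ne, map_eq_zero_iff _ (toEuclideanLin_injective hR)]
    exact (EuclideanSpace.basisFun (Fin n) ℝ).orthonormal.ne_zero k
  positivity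

theorem IsBasisOf.map_matrix (hl : IsBasisOf l L) {R : Matrix (Fin n) (Fin n) ℝ} (hR : R.det ≠ 0) :
    IsBasisOf (fun i => Matrix.toEuclideanLin R (l i)) (matImage R L) := by
  refine ⟨hl.1.map' _ (LinearMap.ker_eq_bot.2 (toEuclideanLin_injective hR)), ?_⟩
  rw [matImage, ← hl.2, Submodule.map_span, ← Set.range_comp]
  rfl

theorem IsBasisOf.span_eq_top {l : Fin n → E n} (hl : IsBasisOf l L) :
    Submodule.span ℝ (Set.range l) = ⊤ := by
  refine Submodule.eq_top_of_finrank_eq ?_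
  rw [finrank_span_eq_card hl.1, Fintype.card_fin, finrank_euclideanSpace_fin]

/-- The transpose of R sends u to a family in L* of squared volume at most (tr(RᵀR)/e)^e times that
of u. Taking the power -1/e of volumes turns this factor into √e/√tr(RᵀR), which is where the √dim
in `klBound` comes from. -/
theorem IsBasisOf.ofReal_le_mul_etaDet {l : Fin n → E n} (hl : IsBasisOf l L)
    {R : Matrix (Fin n) (Fin n) ℝ} (hR : R.det ≠ 0) {e : ℕ} (hW1 : 1 ≤ e) {u : Fin e → E n}
    (huR : ∀ i, u i ∈ dual (matImage R L)) (hui : LinearIndependent ℝ u) :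
    ENNReal.ofReal (√e * √(gramDet u) ^ (-(1 / (e : ℝ)))) ≤
      ENNReal.ofReal (√(R.transpose * R).trace) * etaDet L := by
  have hRl := hl.map_matrix hR
  have : Nonempty (Fin e) := ⟨⟨0, hW1⟩⟩
  have hn : 1 ≤ n := hW1.trans (by simpa using hui.fintype_card_le_finrank)
  set T := Matrix.toEuclideanLin R.transpose
  have hTinj : Function.Injective T := toEuclideanLin_injective (by rwa [Matrix.det_transpose])
  have hv : ∀ i, T (u i) ∈ dual L := fun i => by
    rw [hl.mem_dual_iff, hl.span_eq_top]
    refine ⟨trivial, fun j => ?_⟩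
    rw [inner_toEuclideanLin_transpose]
    exact (hRl.mem_dual_iff.1 (huR i)).2 j
  have hvi : LinearIndependent ℝ (fun i => T (u i)) :=
    hui.map' _ (LinearMap.ker_eq_bot.2 hTinj)
  obtain ⟨hW', hWe', hpos, hle⟩ := hl.latticeDet_slice_le hv hvi
  have htr := trace_transpose_mul_self_pos hn hR
  have h1 := gramDet_map_le_pow_mul T (EuclideanSpace.basisFun (Fin n) ℝ) u
  rw [sum_norm_sq_toEuclideanLin, Matrix.transpose_transpose, Matrix.trace_mul_comm,
    Fintype.card_fin] at h1
  set τ := (R.transpose * R).trace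
  set W' := Submodule.span ℝ (Set.range fun i => T (u i))
  set D := latticeDet (slice (dual L) W')
  have he0 : (0 : ℝ) < e := by exact_mod_cast hW1
  have hgu := gramDet_pos hui
  have h2 : D ≤ √(τ / e) ^ e * √(gramDet u) := by
    refine hle.trans ?_
    rw [Real.sqrt_le_iff]
    refine ⟨by positivity, h1.trans_eq ?_⟩
    rw [mul_pow, Real.sq_sqrt hgu.le, ← pow_mul, mul_comm e 2, pow_mul,
      Real.sq_sqrt (by positivity)]
  have h3 : √e * √(gramDet u) ^ (-(1 / (e : ℝ))) ≤ √τ * D ^ (-(1 / (e : ℝ))) := by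
    have hτe : 0 < √(τ / e) := by positivity
    have h4 : (√(τ / e) ^ e * √(gramDet u)) ^ (-(1 / (e : ℝ))) ≤ D ^ (-(1 / (e : ℝ))) :=
      Real.rpow_le_rpow_of_nonpos hpos h2 (by rw [Left.neg_nonpos_iff]; positivity)
    rw [Real.mul_rpow (by positivity) (by positivity), Real.rpow_neg (by positivity) (1 / (e : ℝ)),
      one_div, Real.pow_rpow_inv_natCast hτe.le (by omega), Real.sqrt_div htr.le, inv_div] at h4
    have hτ : 0 < √τ := by positivity
    rw [one_div]
    calc √e * √(gramDet u) ^ (-(e : ℝ)⁻¹) = √τ * (√e / √τ * √(gramDet u) ^ (-(e : ℝ)⁻¹)) := by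
          field_simp
      _ ≤ _ := by gcongr
  refine (ENNReal.ofReal_le_ofReal h3).trans ?_
  rw [ENNReal.ofReal_mul (Real.sqrt_nonneg _)]
  gcongr
  refine le_trans ?_ (le_iSup₂_of_le W' hW' (le_iSup_of_le (by rw [hWe']; exact hW1) le_rfl))
  rw [hWe']

theorem klBound_matImage_le (hL : IsLatticeOfDim n L) {R : Matrix (Fin n) (Fin n) ℝ}
    (hR : R.det ≠ 0) :
    klBound (matImage R L) ≤ ENNReal.ofReal (√(R.transpose * R).trace) * etaDet L := by
  obtain ⟨l, hl⟩ := hL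
  refine iSup_le fun W => iSup₂_le fun hW hW1 => ?_
  obtain ⟨u, hu⟩ := (hl.map_matrix hR).exists_basis_slice hW
  rw [latticeDet_eq hu]
  exact hl.ofReal_le_mul_etaDet hR hW1 (fun i => (hu.mem i).1) hu.1

theorem etaMuCirc_le_mul_etaDet (hL : IsLatticeOfDim n L) {C : ℝ≥0∞}
    (hC : ∀ L : Submodule ℤ (E n), IsLattice L → coveringRadius L ≤ C * klBound L) :
    etaMuCirc L ≤ C * etaDet L := by
  refine iSup₂_le fun R hR => ENNReal.div_le_of_le_mul ?_
  have hRL : IsLattice (matImage R L) := by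
    obtain ⟨l, hl⟩ := hL
    exact ⟨n, _, hl.map_matrix hR⟩
  calc coveringRadius (matImage R L) ≤ C * klBound (matImage R L) := hC _ hRL
    _ ≤ C * (ENNReal.ofReal (√(R.transpose * R).trace) * etaDet L) := by
      gcongr
      exact klBound_matImage_le hL hR
    _ = _ := by ring

/-- Constants of this form are attained. -/
theorem isLeast_sInf_mul {α : Type*} {p : α → Prop} {f g : α → ℝ≥0∞} (hg : ∀ a, p a → g a ≠ ⊤)
    (h0 : ∀ a, p a → g a = 0 → f a = 0) :
    IsLeast {C : ℝ≥0∞ | ∀ a, p a → f a ≤ C * g a} (sInf {C : ℝ≥0∞ | ∀ a, p a → f a ≤ C * g a}) := by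
  refine ⟨fun a ha => ?_, fun C hC => sInf_le hC⟩
  by_cases h : g a = 0
  -- When g a vanishes the condition holds for every C; otherwise it reads f a / g a ≤ C, which
  -- passes to the infimum.
  · rw [h0 a ha h]; exact zero_le
  · rw [← ENNReal.div_le_iff_le_mul (.inl h) (.inl (hg a ha))]
    exact le_sInf fun C hC => (ENNReal.div_le_iff_le_mul (.inl h) (.inl (hg a ha))).2 (hC a ha)

theorem etaDet_ne_zero (hn : 1 ≤ n) (hL : IsLatticeOfDim n L) : etaDet L ≠ 0 := by
  obtain ⟨l, hl⟩ := hL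
  obtain ⟨m, hm, -, -⟩ := hl.exists_dual
  obtain ⟨hW, hWe, hpos, -⟩ := hl.latticeDet_slice_le hm.mem hm.1
  refine (lt_of_lt_of_le ?_ (le_iSup₂_of_le _ hW (le_iSup_of_le (by omega) le_rfl))).ne'
  exact ENNReal.ofReal_pos.2 (Real.rpow_pos_of_pos hpos _)

theorem IsBasisOf.klBound_pos (hl : IsBasisOf l L) (hd : 1 ≤ d) : 0 < klBound L := by
  obtain ⟨m, hm, -, -⟩ := hl.exists_dual
  obtain ⟨hW, hWe, hpos, -⟩ := hl.latticeDet_slice_le hm.mem hm.1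
  refine lt_of_lt_of_le ?_ (le_iSup₂_of_le _ hW (le_iSup_of_le (by omega) le_rfl))
  refine ENNReal.ofReal_pos.2 (mul_pos (Real.sqrt_pos.2 ?_) (Real.rpow_pos_of_pos hpos _))
  rw [hWe]
  exact_mod_cast hd

theorem coveringRadius_le {r : ℝ≥0}
    (h : ∀ x ∈ Submodule.span ℝ (L : Set (E n)), ∃ y ∈ L, ‖x - y‖ ≤ r) : coveringRadius L ≤ r :=
  iInf₂_le r h

theorem IsBasisOf.coveringRadius_eq_zero {l : Fin 0 → E n} (hl : IsBasisOf l L) :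
    coveringRadius L = 0 := by
  refine le_antisymm (coveringRadius_le (r := 0) fun x hx => ⟨0, zero_mem _, ?_⟩) (zero_le)
  rw [hl.span_real] at hx
  have : x = 0 := by simpa using hx
  simp [this]

theorem isLeast_detConst (hn : 1 ≤ n) :
    IsLeast {C : ℝ≥0∞ | ∀ L : Submodule ℤ (E n), IsLatticeOfDim n L →
      etaMuCirc L ≤ C * etaDet L} (detConst n) :=
  isLeast_sInf_mul (fun _ hL => IsLattice.etaDet_ne_top ⟨n, hL⟩)
    (fun _ hL h => absurd h (etaDet_ne_zero hn hL))

theorem isLeast_klConst (n : ℕ) :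
    IsLeast {C : ℝ≥0∞ | ∀ L : Submodule ℤ (E n), IsLattice L →
      coveringRadius L ≤ C * klBound L} (klConst n) := by
  refine isLeast_sInf_mul (fun _ hL => hL.klBound_ne_top) ?_
  rintro L ⟨d, l, hl⟩ h
  rcases Nat.eq_zero_or_pos d with rfl | hd
  · exact hl.coveringRadius_eq_zero
  · exact absurd h (hl.klBound_pos hd).ne'

theorem detConst_le_klConst (n : ℕ) : detConst n ≤ klConst n :=
  sInf_le fun _ hL => etaMuCirc_le_mul_etaDet hL (isLeast_klConst n).1

end

/-! ### The logarithmic upper bound. -/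

section

section diagMap

variable {F : Type*} [NormedAddCommGroup F] [InnerProductSpace ℝ F] {ι : Type*} [Fintype ι]

theorem inner_diagMap_left (e : ι → F) (a : ι → ℝ) (x y : F) :
    inner ℝ (diagMap e a x) y = inner ℝ x (diagMap e a y) := by
  rw [diagMap_apply, diagMap_apply, sum_inner, inner_sum]
  refine Finset.sum_congr rfl fun i _ => ?_
  rw [real_inner_smul_left, real_inner_smul_right, real_inner_comm x (e i)]
  ring

theorem diagMap_diagMap {e : ι → F} (he : Orthonormal ℝ e)
    (hspan : Submodule.span ℝ (Set.range e) = ⊤) {a b : ι → ℝ} (hab : ∀ i, a i * b i = 1) (x : F) :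
    diagMap e a (diagMap e b x) = x := by
  rw [← sub_eq_zero]
  refine eq_zero_of_mem_span_of_inner_eq_zero (b := e) (by rw [hspan]; trivial) fun i => ?_
  rw [real_inner_comm, inner_sub_right, inner_diagMap he, inner_diagMap he, ← mul_assoc, hab,
    one_mul, sub_self]

theorem diagMap_eq_zero_of_mem {e : ι → F} {a : ι → ℝ} {V : Submodule ℝ F} (h : ∀ i, e i ∈ Vᗮ)
    {x : F} (hx : x ∈ V) : diagMap e a x = 0 := by
  rw [diagMap_apply]
  refine Finset.sum_eq_zero fun i _ => ?_
  rw [Submodule.inner_left_of_mem_orthogonal hx (h i), zero_mul, zero_smul]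

end diagMap

variable {n d : ℕ} {L : Submodule ℤ (E n)} {l : Fin d → E n}

theorem etaDet_le_one (hL : IsLattice L) (h : GramDetGeOne (dual L)) : etaDet L ≤ 1 := by
  obtain ⟨d, l, hl⟩ := hL
  refine iSup_le fun W => iSup₂_le fun hW hW1 => ?_
  obtain ⟨u, hu⟩ := hl.exists_basis_slice hW
  rw [latticeDet_eq hu, gramVol_eq_sqrt, ← ENNReal.ofReal_one]
  refine ENNReal.ofReal_le_ofReal ?_
  have h1 := h _ u (fun i => (hu.mem i).1) (linearIndependent_int_of_real hu.1)
  simpa using rpow_neg_inv_le one_pos hW1 (V := √(gramDet u)) (by simpa using h1)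

/-- If scaling `L*` along the orthonormal family `e` makes all Gram determinants at least `1`,
then the covering radius of `L` is controlled by the trace of the scaling. -/
theorem IsBasisOf.coveringRadius_le_detConst_mul (hn : 1 ≤ n) (hl : IsBasisOf l L)
    {e : Fin d → E n} (he : Orthonormal ℝ e)
    (hspan : Submodule.span ℝ (Set.range e) = Submodule.span ℝ (Set.range l))
    {a : Fin d → ℝ} (ha : ∀ i, 0 < a i)
    (hgood : GramDetGeOne ((dual L).map ((diagMap e a).restrictScalars ℤ)))
    {s : ℝ} (hs : 0 < s) :
    coveringRadius L ≤ detConst n * ENNReal.ofReal (√(∑ i, a i ^ 2 + n * s ^ 2)) := by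
  set V := Submodule.span ℝ (Set.range l) with hV
  have hlV : ∀ i, l i ∈ V := fun i => Submodule.subset_span (Set.mem_range_self i)
  have heV : ∀ i, e i ∈ V := fun i => hspan.le (Submodule.subset_span (Set.mem_range_self i))
  set k := Module.finrank ℝ Vᗮ with hk
  -- `detConst` concerns full-dimensional lattices only, so L is completed in Vᗮ.
  let f := stdOrthonormalBasis ℝ Vᗮ
  let f' : Fin k → E n := fun j => (f j : E n)
  have hf'V : ∀ j, f' j ∈ Vᗮ := fun j => (f j).2
  have hf' : Orthonormal ℝ f' := f.orthonormal.comp_linearIsometry Vᗮ.subtypeₗᵢ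
  have hf'span : Submodule.span ℝ (Set.range f') = Vᗮ := by
    have h1 := congrArg (Submodule.map Vᗮ.subtype) f.toBasis.span_eq
    rw [Submodule.map_span, ← Set.range_comp, Submodule.map_subtype_top] at h1
    simpa [Function.comp_def] using h1
  have hdk : d + k = n := by
    have h1 := V.finrank_add_finrank_orthogonal
    rw [finrank_span_eq_card hl.1, Fintype.card_fin, finrank_euclideanSpace_fin] at h1
    exact h1
  let g : Fin d ⊕ Fin k → E n := Sum.elim e f'
  have hg : Orthonormal ℝ g := orthonormal_sumElim he hf' fun i j =>
    Submodule.inner_right_of_mem_orthogonal (heV i) (hf'V j)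
  have hgspan : Submodule.span ℝ (Set.range g) = ⊤ := by
    rw [Set.Sum.elim_range, Submodule.span_union, hspan, hf'span,
      Submodule.sup_orthogonal_of_hasOrthogonalProjection]
  let α : Fin d ⊕ Fin k → ℝ := Sum.elim a fun _ => s
  have hα : ∀ i, 0 < α i := by rintro (i | i); exacts [ha i, hs]
  set A := diagMap g α with hA
  set B := diagMap g α⁻¹ with hB
  have hAB : ∀ x, A (B x) = x :=
    diagMap_diagMap hg hgspan fun i => mul_inv_cancel₀ (hα i).ne'
  have hBA : ∀ x, B (A x) = x :=
    diagMap_diagMap hg hgspan fun i => inv_mul_cancel₀ (hα i).ne'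
  have hAV : ∀ x ∈ V, A x = diagMap e a x := fun x hx => by
    rw [hA, diagMap_sumElim, diagMap_eq_zero_of_mem hf'V hx, add_zero]
  have hBV : ∀ x ∈ V, B x ∈ V := fun x hx => by
    have : α⁻¹ = Sum.elim a⁻¹ (fun _ => s⁻¹) := by ext (i | i) <;> rfl
    rw [hB, this, diagMap_sumElim, diagMap_eq_zero_of_mem hf'V hx, add_zero, ← hspan]
    exact diagMap_mem_span _ _ _
  have hAf : ∀ j, A (f' j) = s • f' j := fun j => diagMap_apply_self hg α (Sum.inr j)
  have hBinj : Function.Injective B := Function.LeftInverse.injective hAB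
  let R : Matrix (Fin n) (Fin n) ℝ := Matrix.toEuclideanLin.symm A
  have hRA : Matrix.toEuclideanLin R = A := LinearEquiv.apply_symm_apply _ _
  have hR : R.det ≠ 0 := by
    intro h0
    obtain ⟨v, hv, hRv⟩ := Matrix.exists_mulVec_eq_zero_iff.2 h0
    have h1 : Matrix.toEuclideanLin R (WithLp.toLp 2 v) = 0 := by
      rw [Matrix.toLpLin_toLp, Matrix.toLin'_apply, hRv]
      rfl
    rw [hRA] at h1
    have h2 := hBA (WithLp.toLp 2 v)
    rw [h1, map_zero] at h2
    exact hv (congrArg WithLp.ofLp h2).symm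
  -- With B inverse to the symmetric map A, the dual of the lattice spanned by l' is A(L*) plus the
  -- integer span of f', and A maps L' to L plus the span of the s • f' j.
  let l' : Fin d ⊕ Fin k → E n := Sum.elim (fun i => B (l i)) f'
  let σ : Fin n ≃ Fin d ⊕ Fin k := (finCongr hdk.symm).trans finSumFinEquiv.symm
  let L' := Submodule.span ℤ (Set.range l')
  have hl'L : ∀ i, l' i ∈ L' := fun i => Submodule.subset_span (Set.mem_range_self i)
  have hl'i : LinearIndependent ℝ l' := by
    refine LinearIndependent.sum_type (hl.1.map' B (LinearMap.ker_eq_bot.2 hBinj))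
      hf'.linearIndependent (Disjoint.mono ?_ hf'span.le V.orthogonal_disjoint)
    rw [Submodule.span_le]
    rintro _ ⟨i, rfl⟩
    exact hBV _ (hlV i)
  have hL' : IsLatticeOfDim n L' :=
    ⟨l' ∘ σ, hl'i.comp _ σ.injective, by rw [σ.surjective.range_comp]⟩
  have hdual : GramDetGeOne (dual L') := by
    refine GramDetGeOne.of_inf_of_map V (hgood.mono ?_) ?_
    · rintro c ⟨hc, hcV⟩
      refine ⟨B c, ?_, ?_⟩
      · refine hl.mem_dual_iff.2 ⟨hBV c hcV, fun i => ?_⟩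
        rw [hB, inner_diagMap_left]
        exact hc.2 _ (hl'L (Sum.inl i))
      · rw [LinearMap.restrictScalars_apply, ← hAV _ (hBV c hcV), hAB]
    · intro e c hc hci
      choose y hyL hy using hc
      let w : Fin e → Vᗮ := fun i => Vᗮ.orthogonalProjectionOnto (y i)
      have hw : ∀ i, (w i : E n) = c i := hy
      have h1 : gramDet c = gramDet (fun i => f.repr (w i)) := by
        unfold gramDet
        congr 1
        ext i j
        rw [Matrix.gram_apply, Matrix.gram_apply, LinearIsometryEquiv.inner_map_map, ← hw, ← hw]
        rfl
      rw [h1]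
      refine (linearIndependent_and_one_le_gramDet_of_int (fun i j => ?_) ?_).2
      · obtain ⟨z, hz⟩ := (hyL i).2 _ (hl'L (Sum.inr j))
        refine ⟨z, ?_⟩
        rw [f.repr_apply_apply, Submodule.inner_orthogonalProjectionOnto_eq_of_mem_left,
          ← hz, real_inner_comm]
        rfl
      · have h2 : LinearIndependent ℤ w := by
          refine LinearIndependent.of_comp (Vᗮ.subtype.restrictScalars ℤ) ?_
          convert hci using 1
          ext1 i
          exact hw i
        exact h2.map' (f.repr.toLinearEquiv.toLinearMap.restrictScalars ℤ)
          (LinearMap.ker_eq_bot.2 f.repr.injective)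
  -- Orthogonal projection onto V sends RL' into L, fixes V and does not increase distances.
  have hcov : coveringRadius L ≤ coveringRadius (matImage R L') := by
    refine le_iInf₂ fun r hr => coveringRadius_le fun x hx => ?_
    rw [hl.span_real] at hx
    have hx' : x ∈ Submodule.span ℝ (matImage R L' : Set (E n)) := by
      refine Submodule.span_mono ?_ hx
      rintro _ ⟨i, rfl⟩
      refine ⟨B (l i), hl'L (Sum.inl i), ?_⟩
      rw [LinearMap.restrictScalars_apply, hRA, hAB]
    obtain ⟨y, ⟨z, hz, rfl⟩, hy⟩ := hr x hx'
    rw [LinearMap.restrictScalars_apply, hRA] at hy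
    refine ⟨V.starProjection (A z), ?_, ?_⟩
    · have h1 : L' ≤ L.comap (((V.starProjection : E n →ₗ[ℝ] E n) ∘ₗ A).restrictScalars ℤ) := by
        rw [Submodule.span_le]
        rintro _ ⟨i | i, rfl⟩
        · change V.starProjection (A (B (l i))) ∈ L
          rw [hAB, Submodule.starProjection_eq_self_iff.2 (hlV i)]
          exact hl.mem i
        · change V.starProjection (A (f' i)) ∈ L
          rw [hAf, map_smul, (Submodule.starProjection_apply_eq_zero_iff V).2 (hf'V i), smul_zero]
          exact zero_mem L
      exact h1 hz
    · have h1 : x - V.starProjection (A z) = V.starProjection (x - A z) := by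
        rw [map_sub, Submodule.starProjection_eq_self_iff.2 hx]
      rw [h1]
      exact (Submodule.norm_starProjection_apply_le _ _).trans hy
  have htr : (R.transpose * R).trace ≤ ∑ i, a i ^ 2 + n * s ^ 2 := by
    let gb : OrthonormalBasis (Fin d ⊕ Fin k) ℝ (E n) := OrthonormalBasis.mk hg hgspan.ge
    rw [← sum_norm_sq_toEuclideanLin, hRA]
    refine (sum_norm_sq_map_le A gb (EuclideanSpace.basisFun (Fin n) ℝ).orthonormal).trans ?_
    have h1 : ∀ i, ‖A (gb i)‖ ^ 2 = α i ^ 2 := fun i => by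
      rw [show gb i = g i by simp [gb], hA, diagMap_apply_self hg, norm_smul, hg.1, mul_one,
        Real.norm_eq_abs, sq_abs]
    simp only [h1]
    rw [Fintype.sum_sum_type]
    have h2 : (k : ℝ) ≤ n := by exact_mod_cast (by omega : k ≤ n)
    simp only [α, Sum.elim_inl, Sum.elim_inr, Finset.sum_const, Finset.card_univ,
      Fintype.card_fin, nsmul_eq_mul]
    gcongr
  have htr0 := trace_transpose_mul_self_pos hn hR
  have h1 : coveringRadius (matImage R L') / ENNReal.ofReal (√(R.transpose * R).trace) ≤
      detConst n * etaDet L' :=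
    le_trans (le_iSup₂ (f := fun (R : Matrix (Fin n) (Fin n) ℝ) (_ : R.det ≠ 0) =>
      coveringRadius (matImage R L') / ENNReal.ofReal (√(R.transpose * R).trace)) R hR)
      ((isLeast_detConst hn).1 L' hL')
  rw [ENNReal.div_le_iff (ENNReal.ofReal_pos.2 (Real.sqrt_pos.2 htr0)).ne'
    ENNReal.ofReal_ne_top] at h1
  calc coveringRadius L ≤ _ := hcov
    _ ≤ detConst n * etaDet L' * ENNReal.ofReal (√(R.transpose * R).trace) := h1
    _ ≤ detConst n * 1 * ENNReal.ofReal (√(∑ i, a i ^ 2 + n * s ^ 2)) := by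
      gcongr
      exact etaDet_le_one ⟨n, hL'⟩ hdual
    _ = _ := by rw [mul_one]

theorem sum_inv_succ_le (d : ℕ) : ∑ j : Fin d, ((j : ℝ) + 1)⁻¹ ≤ 1 + Real.log d := by
  have h := harmonic_le_one_add_log d
  rw [harmonic] at h
  push_cast at h
  rwa [Fin.sum_univ_eq_sum_range (fun j : ℕ => ((j : ℝ) + 1)⁻¹) d]

/-- The family attached to t_j gives 1/t_j ≤ 2κ²/(j+1) with κ = `klBound L`, so the trace is at most
κ²(3 + 2 log n). The covering radius involves only its square root; the stated factor 2(1 + log n)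
is generous. -/
theorem IsBasisOf.coveringRadius_le_log_mul (hn : 1 ≤ n) (hl : IsBasisOf l L) :
    coveringRadius L ≤
      ENNReal.ofReal (2 * (1 + Real.log n)) * detConst n * klBound L := by
  rcases Nat.eq_zero_or_pos d with rfl | hd
  · rw [hl.coveringRadius_eq_zero]; exact zero_le
  obtain ⟨m, hm, hmspan, -⟩ := hl.exists_dual
  obtain ⟨c₀, hc₀, hlb⟩ := hl.exists_pow_le_gramDet
  obtain ⟨e, t, he, hspan, ht, hgood, hfam⟩ := exists_scaling d (dual L)
    (by rw [hm.span_real, finrank_span_eq_card hm.1, Fintype.card_fin]) c₀ hc₀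
    (fun e c hc hci => (hlb e c hc hci).2) 2 one_lt_two
  rw [hm.span_real, hmspan] at hspan
  have htop : klBound L ≠ ⊤ := IsLattice.klBound_ne_top ⟨d, l, hl⟩
  set κ := (klBound L).toReal
  have hκ : 0 < κ := ENNReal.toReal_pos (hl.klBound_pos hd).ne' htop
  have hn0 : (0 : ℝ) < n := by exact_mod_cast hn
  have ht' : ∀ j : Fin d, (t j)⁻¹ ≤ 2 * κ ^ 2 * ((j : ℝ) + 1)⁻¹ := fun j => by
    obtain ⟨q, c, hjq, hc, hci, hct⟩ := hfam j
    have htj := ht j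
    have h1 := hl.le_klBound (by omega) hc (hlb q c hc hci).1 (by positivity) hct
    rw [ENNReal.ofReal_le_iff_le_toReal htop] at h1
    have h2 : (√q * (√(2 * t j))⁻¹) ^ 2 ≤ κ ^ 2 := by gcongr
    rw [mul_pow, inv_pow, Real.sq_sqrt (by positivity), Real.sq_sqrt (by positivity)] at h2
    have h3 : (j : ℝ) + 1 ≤ q := by exact_mod_cast hjq
    have h4 : ((j : ℝ) + 1) * (2 * t j)⁻¹ ≤ κ ^ 2 := le_trans (by gcongr) h2
    rw [← div_eq_mul_inv, le_div_iff₀ (by positivity)]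
    rw [mul_inv] at h4
    linarith
  have hdn : d ≤ n := by simpa using hl.1.fintype_card_le_finrank
  have hlog : 0 ≤ Real.log n := Real.log_natCast_nonneg n
  -- The scale s = κ/√n on the complement makes the completion cost at most κ².
  have hsum : ∑ j, ((√(t j))⁻¹) ^ 2 + n * (κ / √n) ^ 2 ≤ (2 * (1 + Real.log n) * κ) ^ 2 := by
    have h1 : ∑ j, ((√(t j))⁻¹) ^ 2 ≤ 2 * κ ^ 2 * (1 + Real.log n) := by
      calc ∑ j, ((√(t j))⁻¹) ^ 2 ≤ ∑ j : Fin d, 2 * κ ^ 2 * ((j : ℝ) + 1)⁻¹ := by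
            refine Finset.sum_le_sum fun j _ => ?_
            rw [inv_pow, Real.sq_sqrt (ht j).le]
            exact ht' j
        _ = 2 * κ ^ 2 * ∑ j : Fin d, ((j : ℝ) + 1)⁻¹ := by rw [Finset.mul_sum]
        _ ≤ 2 * κ ^ 2 * (1 + Real.log d) := by gcongr; exact sum_inv_succ_le d
        _ ≤ _ := by gcongr
    have h2 : n * (κ / √n) ^ 2 = κ ^ 2 := by
      rw [div_pow, Real.sq_sqrt hn0.le]
      field_simp
    rw [h2]
    nlinarith [mul_nonneg (sq_nonneg κ) hlog, mul_nonneg (sq_nonneg κ) (sq_nonneg (Real.log n))]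
  have h1 := hl.coveringRadius_le_detConst_mul hn he hspan
    (fun i => inv_pos.2 (Real.sqrt_pos.2 (ht i))) hgood (s := κ / √n) (by positivity)
  calc coveringRadius L ≤ _ := h1
    _ ≤ detConst n * ENNReal.ofReal (2 * (1 + Real.log n) * κ) := by
      gcongr
      exact Real.sqrt_le_iff.2 ⟨by positivity, hsum⟩
    _ = _ := by
      rw [ENNReal.ofReal_mul (by positivity), ENNReal.ofReal_toReal htop]
      ring

theorem klConst_le_log_mul_detConst (hn : 1 ≤ n) :
    klConst n ≤ ENNReal.ofReal (2 * (1 + Real.log n)) * detConst n := by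
  refine sInf_le ?_
  rintro L ⟨d, l, hl⟩
  exact hl.coveringRadius_le_log_mul hn

end

/-! ### Finiteness by transference, and positivity from ℤⁿ. -/

section

section transference

variable {F : Type*} [NormedAddCommGroup F] [InnerProductSpace ℝ F] [FiniteDimensional ℝ F]

omit [FiniteDimensional ℝ F] in
theorem norm_sq_eq_of_span_singleton {w : F} (hw : w ≠ 0) (x : F) :
    ‖x‖ ^ 2 = (inner ℝ w x) ^ 2 / ‖w‖ ^ 2 +
      ‖(Submodule.span ℝ {w})ᗮ.starProjection x‖ ^ 2 := by
  have hw0 : 0 < ‖w‖ := norm_pos_iff.2 hw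
  rw [Submodule.norm_sq_eq_add_norm_sq_starProjection x (Submodule.span ℝ {w}),
    Submodule.starProjection_singleton, norm_smul, Real.norm_eq_abs, mul_pow, sq_abs]
  congr 1
  simp only [RCLike.ofReal_real_eq_id, id_eq]
  field_simp

/-- Reduction of a vector modulo an integer multiple of `w`. -/
theorem norm_sub_round_zsmul_sq_le {w : F} (hw : w ≠ 0) (u : F) :
    ‖u - round (inner ℝ w u / ‖w‖ ^ 2 : ℝ) • w‖ ^ 2 ≤
      ‖w‖ ^ 2 / 4 + ‖(Submodule.span ℝ {w})ᗮ.starProjection u‖ ^ 2 := by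
  have hw0 : 0 < ‖w‖ := norm_pos_iff.2 hw
  set q : ℝ := inner ℝ w u / ‖w‖ ^ 2
  have hq : inner ℝ w u = q * ‖w‖ ^ 2 := by simp only [q]; field_simp
  have hw1 : (Submodule.span ℝ {w})ᗮ.starProjection w = 0 :=
    orthProj_eq_zero_iff.2 (Submodule.mem_span_singleton_self w)
  rw [norm_sq_eq_of_span_singleton hw, map_sub, map_zsmul, hw1, smul_zero, sub_zero,
    inner_sub_right, ← Int.cast_smul_eq_zsmul ℝ, real_inner_smul_right, hq,
    real_inner_self_eq_norm_sq, ← sub_mul, mul_pow]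
  have h1 := abs_sub_round q
  have h2 : (q - round q) ^ 2 ≤ 1 / 4 := by
    rw [← sq_abs]
    nlinarith [abs_nonneg (q - round q)]
  refine add_le_add ?_ le_rfl
  rw [div_le_iff₀ (by positivity)]
  nlinarith [pow_pos hw0 4]

/-- A basis of the lattice spanned by `b` starts with any nonzero vector which is nearly
shortest. -/
theorem exists_basis_cons {d : ℕ} {b : Fin (d + 1) → F} (hb : LinearIndependent ℝ b) {ρ : ℝ}
    (hρ : 0 < ρ) (hlb : ∀ u ∈ Submodule.span ℤ (Set.range b), u ≠ 0 → ρ ≤ ‖u‖) {w : F}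
    (hwM : w ∈ Submodule.span ℤ (Set.range b)) (hw0 : w ≠ 0) (hw : ‖w‖ ^ 2 ≤ 2 * ρ ^ 2) :
    ∃ v : Fin d → F, Submodule.span ℤ (Set.range b) =
        Submodule.span ℤ (Set.range (Sum.elim (fun _ : Fin 1 => w) v)) ∧
      LinearIndependent ℝ (fun j => (Submodule.span ℝ {w})ᗮ.starProjection (v j)) := by
  set M := Submodule.span ℤ (Set.range b)
  set V := Submodule.span ℝ {w} with hV
  let bM : Module.Basis (Fin (d + 1)) ℤ M := Module.Basis.span (linearIndependent_int_of_real hb)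
  have : Module.Finite ℤ M := Module.Finite.of_basis bM
  have : Module.IsTorsionFree ℤ F := .trans_faithfulSMul ℤ ℝ F
  let p : M →ₗ[ℤ] F := (orthProj V) ∘ₗ M.subtype
  let wM : Fin 1 → M := fun _ => ⟨w, hwM⟩
  have hwMi : LinearIndependent ℤ wM := by
    refine LinearIndependent.of_subsingleton 0 ?_
    simpa [wM] using hw0
  have hKp : Submodule.span ℤ (Set.range wM) = LinearMap.ker p := by
    apply le_antisymm
    · rw [Submodule.span_le]
      rintro _ ⟨i, rfl⟩
      exact orthProj_eq_zero_iff.2 (Submodule.mem_span_singleton_self w)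
    · intro u hu
      have hπu : Vᗮ.starProjection (u : F) = 0 := hu
      set r := round (inner ℝ w (u : F) / ‖w‖ ^ 2 : ℝ)
      have h1 : ‖(u : F) - r • w‖ ^ 2 ≤ ‖w‖ ^ 2 / 4 + ‖Vᗮ.starProjection (u : F)‖ ^ 2 :=
        norm_sub_round_zsmul_sq_le hw0 (u : F)
      rw [hπu, norm_zero] at h1
      -- A nearly shortest w is primitive: the remainder of u modulo w has squared norm at most
      -- ‖w‖²/4 ≤ ρ²/2, so it is 0.
      have h2 : (u : F) - r • w = 0 := by
        by_contra h
        have := hlb _ (sub_mem u.2 (zsmul_mem hwM r)) h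
        nlinarith [norm_nonneg ((u : F) - r • w)]
      have h3 : u = r • wM 0 := Subtype.ext (sub_eq_zero.1 h2)
      rw [h3]
      exact zsmul_mem (Submodule.subset_span (Set.mem_range_self 0)) r
  let K := Submodule.span ℤ (Set.range wM)
  have : Module.IsTorsionFree ℤ (M ⧸ LinearMap.ker p) :=
    (LinearMap.quotKerEquivRange p).injective.moduleIsTorsionFree _ (fun a x => map_smul _ a x)
  have : Module.IsTorsionFree ℤ (M ⧸ K) := by
    rw [show K = LinearMap.ker p from hKp]; infer_instance
  have : Module.Free ℤ (M ⧸ K) := Module.free_of_finite_type_torsion_free'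
  let bK : Module.Basis (Fin 1) ℤ K := Module.Basis.span hwMi
  let bQ' := Module.finBasis ℤ (M ⧸ K)
  have hcard : Module.finrank ℤ (M ⧸ K) = d := by
    have h1 := Fintype.card_congr ((bK.sumQuot bQ').indexEquiv bM)
    rw [Fintype.card_sum, Fintype.card_fin, Fintype.card_fin, Fintype.card_fin] at h1
    omega
  let bQ := bQ'.reindex (finCongr hcard)
  let B := bK.sumQuot bQ
  let v : Fin d → F := fun j => B (Sum.inr j)
  have hBw : (fun i => (B i : F)) = Sum.elim (fun _ : Fin 1 => w) v := by
    ext1 (i | i)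
    · have h1 : B (Sum.inl i) = bK i := Module.Basis.sumQuot_inl bK bQ i
      have h2 : (bK i : M) = wM i :=
        congrArg Subtype.val (Module.Basis.span_apply hwMi i)
      change (B (Sum.inl i) : F) = w
      rw [h1, h2]
    · rfl
  refine ⟨v, ?_, ?_⟩
  · have h1 := congrArg (Submodule.map M.subtype) B.span_eq
    rw [Submodule.map_span, ← Set.range_comp, Submodule.map_subtype_top] at h1
    rw [← hBw]
    exact h1.symm
  · have h1 : gramDet (Sum.elim (fun _ : Fin 1 => w) v) = gramDet b := by
      rw [← hBw]
      have h2 := gramDet_basis_eq B bM M.subtype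
      have h3 : (fun i => M.subtype (bM i)) = b := by
        ext1 i
        exact congrArg Subtype.val (Module.Basis.span_apply (linearIndependent_int_of_real hb) i)
      rw [h3] at h2
      exact h2
    rw [gramDet_sumElim] at h1
    have h2 := (gramDet_pos hb).ne'
    rw [← h1] at h2
    have h3 := gramDet_ne_zero_iff.1 (right_ne_zero_of_mul h2)
    have h4 : Submodule.span ℝ (Set.range fun _ : Fin 1 => w) = V := by
      rw [Set.range_const]
    simp only [h4] at h3
    exact h3

/-- If all nonzero vectors of the lattice spanned by `b` have norm at least `ρ`, then every point
is within `√(3 ^ d) / ρ` of a point having integer inner products with `b`. -/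
theorem exists_near_integral (d : ℕ) : ∀ b : Fin d → F, LinearIndependent ℝ b → ∀ ρ : ℝ, 0 < ρ →
    (∀ u ∈ Submodule.span ℤ (Set.range b), u ≠ 0 → ρ ≤ ‖u‖) → ∀ x : F, ∃ y : F,
      (∀ u ∈ Submodule.span ℤ (Set.range b), ∃ k : ℤ, inner ℝ y u = (k : ℝ)) ∧
      ‖x - y‖ ^ 2 ≤ 3 ^ d / ρ ^ 2 := by
  induction d with
  | zero =>
    intro b _ ρ _ _ x
    refine ⟨x, fun u hu => ⟨0, ?_⟩, ?_⟩
    · have : u = 0 := by simpa using hu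
      simp [this]
    · rw [sub_self, norm_zero, zero_pow two_ne_zero]
      positivity
  | succ d ih =>
    intro b hb ρ₀ hρ₀ hlb₀ x
    set M := Submodule.span ℤ (Set.range b)
    -- The given bound is replaced by the true infimum of norms, so that a vector w of norm below
    -- 5/4 of it exists; (5/4)² ≤ 2.
    let S : Set ℝ := {s | ∃ u ∈ M, u ≠ 0 ∧ ‖u‖ = s}
    have hne : S.Nonempty :=
      ⟨_, b 0, Submodule.subset_span (Set.mem_range_self 0), hb.ne_zero 0, rfl⟩
    have hρ₀S : ρ₀ ≤ sInf S := le_csInf hne (by rintro _ ⟨u, hu, hu0, rfl⟩; exact hlb₀ u hu hu0)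
    set ρ := sInf S
    have hρ : 0 < ρ := hρ₀.trans_le hρ₀S
    have hlb : ∀ u ∈ M, u ≠ 0 → ρ ≤ ‖u‖ := fun u hu hu0 =>
      csInf_le ⟨0, by rintro _ ⟨u, -, -, rfl⟩; exact norm_nonneg u⟩ ⟨u, hu, hu0, rfl⟩
    obtain ⟨_, ⟨w, hwM, hw0, rfl⟩, hwlt⟩ := exists_lt_of_csInf_lt hne
      (show ρ < 5 / 4 * ρ by linarith)
    have hw : ‖w‖ ^ 2 ≤ 2 * ρ ^ 2 := by nlinarith [norm_nonneg w]
    obtain ⟨v, hMv, hvi⟩ := exists_basis_cons hb hρ hlb hwM hw0 hw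
    set V := Submodule.span ℝ {w} with hV
    have hwpos : 0 < ‖w‖ := norm_pos_iff.2 hw0
    have hvM : ∀ j, v j ∈ M := fun j => by
      rw [show M = _ from hMv]; exact Submodule.subset_span ⟨Sum.inr j, rfl⟩
    -- A projected vector lifts to one reduced modulo w, so ρ² ≤ ‖w‖²/4 + ‖πu‖² ≤ ρ²/2 + ‖πu‖².
    -- Halving ρ² doubles the recursive error, and 1/4 + 2·3^d ≤ 3^(d+1).
    have hlb' : ∀ u ∈ Submodule.span ℤ (Set.range fun j => Vᗮ.starProjection (v j)), u ≠ 0 →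
        ρ / √2 ≤ ‖u‖ := by
      intro u' hu' hu'0
      have h1 : Submodule.span ℤ (Set.range fun j => Vᗮ.starProjection (v j)) ≤
          M.map (orthProj V) := by
        rw [Submodule.span_le]
        rintro _ ⟨j, rfl⟩
        exact ⟨v j, hvM j, rfl⟩
      obtain ⟨u, hu, rfl⟩ := h1 hu'
      rw [orthProj_apply] at hu'0 ⊢
      set r := round (inner ℝ w u / ‖w‖ ^ 2 : ℝ)
      have h2 : ‖u - r • w‖ ^ 2 ≤ ‖w‖ ^ 2 / 4 + ‖Vᗮ.starProjection u‖ ^ 2 :=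
        norm_sub_round_zsmul_sq_le hw0 u
      have h3 : u - r • w ≠ 0 := by
        intro h
        apply hu'0
        rw [sub_eq_zero.1 h, map_zsmul,
          orthProj_eq_zero_iff.2 (Submodule.mem_span_singleton_self w), smul_zero]
      have h4 := hlb _ (sub_mem hu (zsmul_mem hwM r)) h3
      refine le_of_sq_le_sq ?_ (norm_nonneg _)
      rw [div_pow, Real.sq_sqrt zero_le_two]
      nlinarith
    obtain ⟨m, hm, -⟩ := exists_dual_family hvi
    set k := round (inner ℝ w x : ℝ)
    -- The component (k/‖w‖²)w of y makes ⟨y, w⟩ = k but contributes non-integers to ⟨y, v j⟩; z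
    -- cancels these, and the recursion is applied to x - z.
    let z : F := ∑ j, (-(k * inner ℝ w (v j) / ‖w‖ ^ 2)) • m j
    have hz : ∀ j, inner ℝ z (Vᗮ.starProjection (v j)) = -(k * inner ℝ w (v j) / ‖w‖ ^ 2) :=
      fun j => by
        simp only [z]
        rw [sum_inner]
        simp only [real_inner_smul_left]
        rw [Finset.sum_eq_single j (fun i _ hij => by rw [hm, if_neg hij, mul_zero]) (by simp), hm,
          if_pos rfl, mul_one]
    obtain ⟨y', hy', hxy'⟩ := ih _ hvi (ρ / √2) (by positivity) hlb' (x - z)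
    have hπw : ∀ a : F, inner ℝ w (Vᗮ.starProjection a) = 0 := fun a =>
      Submodule.inner_right_of_mem_orthogonal (Submodule.mem_span_singleton_self w)
        (Vᗮ.starProjection_apply_mem a)
    let y : F := (k / ‖w‖ ^ 2) • w + Vᗮ.starProjection (z + y')
    have hyw : inner ℝ w y = k := by
      simp only [y]
      rw [inner_add_right, hπw, real_inner_smul_right, real_inner_self_eq_norm_sq]
      field_simp
      ring
    refine ⟨y, fun u hu => ?_, ?_⟩
    · rw [show M = _ from hMv] at hu
      induction hu using Submodule.span_induction with
      | mem u hu =>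
        obtain ⟨i | j, rfl⟩ := hu
        · exact ⟨k, by rw [real_inner_comm]; exact hyw⟩
        · obtain ⟨q, hq⟩ := hy' _ (Submodule.subset_span (Set.mem_range_self j))
          refine ⟨q, ?_⟩
          simp only [y, Sum.elim_inr]
          rw [inner_add_left, Submodule.inner_starProjection_left_eq_right, inner_add_left, hz,
            hq, real_inner_smul_left]
          ring
      | zero => exact ⟨0, by simp⟩
      | add u₁ u₂ _ _ h₁ h₂ =>
        obtain ⟨k₁, h₁⟩ := h₁
        obtain ⟨k₂, h₂⟩ := h₂
        exact ⟨k₁ + k₂, by rw [inner_add_right, h₁, h₂]; push_cast; rfl⟩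
      | smul r u₁ _ h₁ =>
        obtain ⟨k₁, h₁⟩ := h₁
        refine ⟨r * k₁, ?_⟩
        rw [← Int.cast_smul_eq_zsmul ℝ, real_inner_smul_right, h₁]
        push_cast
        rfl
    · have hπy : Vᗮ.starProjection (x - y) = Vᗮ.starProjection (x - z - y') := by
        have h1 : Vᗮ.starProjection (Vᗮ.starProjection (z + y')) = Vᗮ.starProjection (z + y') :=
          Submodule.starProjection_eq_self_iff.2 (Vᗮ.starProjection_apply_mem _)
        rw [sub_sub x z, map_sub, map_sub]
        congr 1
        simp only [y]
        rw [map_add, h1, map_smul, orthProj_eq_zero_iff.2 (Submodule.mem_span_singleton_self w),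
          smul_zero, zero_add]
      have h0 : ‖x - y‖ ^ 2 = inner ℝ w (x - y) ^ 2 / ‖w‖ ^ 2 + ‖Vᗮ.starProjection (x - y)‖ ^ 2 :=
        norm_sq_eq_of_span_singleton hw0 _
      rw [h0, inner_sub_right, hyw, hπy]
      have h1 : ‖Vᗮ.starProjection (x - z - y')‖ ^ 2 ≤ 2 * 3 ^ d / ρ ^ 2 := by
        calc ‖Vᗮ.starProjection (x - z - y')‖ ^ 2 ≤ ‖x - z - y'‖ ^ 2 := by
              gcongr
              exact Submodule.norm_starProjection_apply_le _ _
          _ ≤ 3 ^ d / (ρ / √2) ^ 2 := hxy'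
          _ = _ := by
            rw [div_pow, Real.sq_sqrt zero_le_two]
            field_simp
      have h2 : (inner ℝ w x - (k : ℝ)) ^ 2 ≤ 1 / 4 := by
        have := abs_sub_round (inner ℝ w x : ℝ)
        rw [← sq_abs]
        nlinarith [abs_nonneg (inner ℝ w x - (k : ℝ))]
      have h3 := hlb w hwM hw0
      have h4 : (1 : ℝ) ≤ 3 ^ d := one_le_pow₀ (by norm_num)
      calc (inner ℝ w x - (k : ℝ)) ^ 2 / ‖w‖ ^ 2 + ‖Vᗮ.starProjection (x - z - y')‖ ^ 2
          ≤ (1 / 4) / ρ ^ 2 + 2 * 3 ^ d / ρ ^ 2 := by gcongr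
        _ = (1 / 4 + 2 * 3 ^ d) / ρ ^ 2 := by rw [add_div]
        _ ≤ 3 ^ (d + 1) / ρ₀ ^ 2 := by
          gcongr
          rw [pow_succ]
          linarith

end transference

variable {n d : ℕ} {L : Submodule ℤ (E n)} {l : Fin d → E n}

/-- Lines W = ℝu already give ‖u‖ ≥ 1/`klBound L` for nonzero u in L*. A point with integer inner
products against the dual basis is then close to x, and its projection to the span of L lies in L.
-/
theorem IsBasisOf.coveringRadius_le_mul_klBound (hl : IsBasisOf l L) :
    coveringRadius L ≤ ENNReal.ofReal (√(3 ^ n)) * klBound L := by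
  rcases Nat.eq_zero_or_pos d with rfl | hd
  · rw [hl.coveringRadius_eq_zero]; exact zero_le
  obtain ⟨m, hm, hmspan, hmL⟩ := hl.exists_dual
  have htop : klBound L ≠ ⊤ := IsLattice.klBound_ne_top ⟨d, l, hl⟩
  set κ := (klBound L).toReal
  have hκ : 0 < κ := ENNReal.toReal_pos (hl.klBound_pos hd).ne' htop
  have hlb : ∀ u ∈ Submodule.span ℤ (Set.range m), u ≠ 0 → κ⁻¹ ≤ ‖u‖ := by
    intro u hu hu0
    rw [hm.2] at hu
    have h1 := hl.le_klBound (e := 1) le_rfl (c := fun _ => u) (fun _ => hu)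
      (LinearIndependent.of_subsingleton 0 hu0) (s := ‖u‖ ^ 2) (by positivity)
      (by rw [gramDet_fin_one, pow_one])
    rw [ENNReal.ofReal_le_iff_le_toReal htop, Real.sqrt_sq (norm_nonneg u)] at h1
    simp only [Nat.cast_one, Real.sqrt_one, one_mul] at h1
    exact inv_le_of_inv_le₀ (norm_pos_iff.2 hu0) h1
  have hdn : d ≤ n := by simpa using hl.1.fintype_card_le_finrank
  rw [← ENNReal.ofReal_toReal htop, ← ENNReal.ofReal_mul (Real.sqrt_nonneg _)]
  refine coveringRadius_le (r := Real.toNNReal (√(3 ^ n) * κ)) fun x hx => ?_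
  rw [hl.span_real] at hx
  obtain ⟨y, hy, hxy⟩ := exists_near_integral d m hm.1 κ⁻¹ (by positivity) hlb x
  set V := Submodule.span ℝ (Set.range l)
  refine ⟨V.starProjection y, hmL _ (V.starProjection_apply_mem y) fun i => ?_, ?_⟩
  · obtain ⟨k, hk⟩ := hy (m i) (Submodule.subset_span (Set.mem_range_self i))
    refine ⟨k, ?_⟩
    have hmi : m i ∈ V := hmspan.le (Submodule.subset_span (Set.mem_range_self i))
    rw [Submodule.inner_starProjection_left_eq_right, Submodule.starProjection_eq_self_iff.2 hmi,
      hk]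
  · have h1 : x - V.starProjection y = V.starProjection (x - y) := by
      rw [map_sub, Submodule.starProjection_eq_self_iff.2 hx]
    rw [h1, Real.coe_toNNReal _ (by positivity)]
    refine (Submodule.norm_starProjection_apply_le _ _).trans ?_
    refine le_of_sq_le_sq (hxy.trans ?_) (by positivity)
    rw [mul_pow, Real.sq_sqrt (by positivity), inv_pow, div_inv_eq_mul]
    gcongr
    norm_num

theorem klConst_lt_top (n : ℕ) : klConst n < ⊤ := by
  refine lt_of_le_of_lt (sInf_le ?_) (ENNReal.ofReal_lt_top (r := √(3 ^ n)))
  rintro L ⟨d, l, hl⟩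
  exact hl.coveringRadius_le_mul_klBound

theorem half_le_coveringRadius_int (hn : 1 ≤ n)
    (hl : IsBasisOf (EuclideanSpace.basisFun (Fin n) ℝ) L) :
    ((1 / 2 : ℝ≥0) : ℝ≥0∞) ≤ coveringRadius L := by
  refine le_iInf₂ fun r hr => ?_
  let i₀ : Fin n := ⟨0, hn⟩
  obtain ⟨y, hy, hxy⟩ := hr ((1 / 2 : ℝ) • EuclideanSpace.basisFun (Fin n) ℝ i₀)
    (by rw [hl.span_real]; exact Submodule.smul_mem _ _ (Submodule.subset_span ⟨i₀, rfl⟩))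
  obtain ⟨z, rfl⟩ := hl.mem_iff.1 hy
  have h1 := (PiLp.norm_apply_le ((1 / 2 : ℝ) • EuclideanSpace.basisFun (Fin n) ℝ i₀ -
    ∑ i, z i • EuclideanSpace.basisFun (Fin n) ℝ i) i₀).trans hxy
  have h2 : ((1 / 2 : ℝ) • EuclideanSpace.basisFun (Fin n) ℝ i₀ -
      ∑ i, z i • EuclideanSpace.basisFun (Fin n) ℝ i) i₀ = 1 / 2 - z i₀ := by
    simp [← Int.cast_smul_eq_zsmul ℝ, Pi.single_apply]
  rw [h2, Real.norm_eq_abs] at h1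
  -- Half a basis vector is a deep enough point: a single coordinate is already 1/2 away from every
  -- integer.
  have h3 : (1 / 2 : ℝ) ≤ |1 / 2 - (z i₀ : ℝ)| := by
    rcases le_or_gt (z i₀) 0 with h | h
    · have : (z i₀ : ℝ) ≤ 0 := by exact_mod_cast h
      rw [abs_of_nonneg] <;> linarith
    · have : (1 : ℝ) ≤ z i₀ := by exact_mod_cast h
      rw [abs_of_nonpos] <;> linarith
  have h4 : (1 / 2 : ℝ≥0) ≤ r := by
    rw [← NNReal.coe_le_coe]
    push_cast
    linarith
  exact_mod_cast h4

theorem detConst_pos (hn : 1 ≤ n) : 0 < detConst n := by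
  have hl : IsBasisOf (EuclideanSpace.basisFun (Fin n) ℝ)
      (Submodule.span ℤ (Set.range (EuclideanSpace.basisFun (Fin n) ℝ))) :=
    ⟨(EuclideanSpace.basisFun (Fin n) ℝ).orthonormal.linearIndependent, rfl⟩
  set L := Submodule.span ℤ (Set.range (EuclideanSpace.basisFun (Fin n) ℝ))
  rw [pos_iff_ne_zero]
  intro h0
  have h1 := (isLeast_detConst hn).1 L ⟨_, hl⟩
  rw [h0, zero_mul] at h1
  have hdet : (1 : Matrix (Fin n) (Fin n) ℝ).det ≠ 0 := by simp
  have h2 : coveringRadius (matImage (1 : Matrix (Fin n) (Fin n) ℝ) L) /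
      ENNReal.ofReal (√((1 : Matrix (Fin n) (Fin n) ℝ).transpose * 1).trace) ≤ 0 :=
    le_trans (le_iSup₂ (f := fun (R : Matrix (Fin n) (Fin n) ℝ) (_ : R.det ≠ 0) =>
      coveringRadius (matImage R L) / ENNReal.ofReal (√(R.transpose * R).trace)) 1 hdet) h1
  have h3 := hl.map_matrix hdet
  have h4 : (fun i => Matrix.toEuclideanLin (1 : Matrix (Fin n) (Fin n) ℝ)
      (EuclideanSpace.basisFun (Fin n) ℝ i)) = EuclideanSpace.basisFun (Fin n) ℝ := by
    ext i j
    simp [Matrix.toEuclideanLin]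
  rw [h4] at h3
  have h5 := half_le_coveringRadius_int hn h3
  rw [nonpos_iff_eq_zero, ENNReal.div_eq_zero_iff] at h2
  rcases h2 with h2 | h2
  · rw [h2] at h5
    simp at h5
  · exact ENNReal.ofReal_ne_top h2

/-! ### Transfer of polylogarithmic bounds. -/

theorem PolylogBounded.of_le {f g : ℕ → ℝ≥0∞} (h : ∀ n, f n ≤ g n) (hg : PolylogBounded g) :
    PolylogBounded f := by
  obtain ⟨A, k, hA⟩ := hg
  exact ⟨A, k, fun n hn => (h n).trans (hA n hn)⟩

theorem PolylogBounded.of_le_log_mul {f g : ℕ → ℝ≥0∞} {K : ℝ} (hK : 0 ≤ K)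
    (h : ∀ n, 1 ≤ n → f n ≤ ENNReal.ofReal (K * (1 + Real.log n)) * g n)
    (hg : PolylogBounded g) : PolylogBounded f := by
  obtain ⟨A, k, hA⟩ := hg
  -- For n ≥ 2, log n ≥ 1/2 and so 1 + log n ≤ 3 log n; the absolute value is taken because A may be
  -- negative.
  refine ⟨3 * K * |A|, k + 1, fun n hn => ?_⟩
  have hn2 : (2 : ℝ) ≤ n := by exact_mod_cast hn
  have h1 : 1 / 2 ≤ Real.log n := by
    have h2 := Real.log_le_log two_pos hn2
    have h3 := Real.log_two_gt_d9
    linarith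
  have h0 : 0 ≤ Real.log n := by linarith
  calc f n ≤ ENNReal.ofReal (K * (1 + Real.log n)) * g n := h n (by omega)
    _ ≤ ENNReal.ofReal (K * (1 + Real.log n)) * ENNReal.ofReal (A * Real.log n ^ k) := by
      gcongr
      exact hA n hn
    _ = ENNReal.ofReal (K * (1 + Real.log n) * (A * Real.log n ^ k)) :=
      (ENNReal.ofReal_mul (by positivity)).symm
    _ ≤ _ := by
      refine ENNReal.ofReal_le_ofReal ?_
      calc K * (1 + Real.log n) * (A * Real.log n ^ k)
          ≤ K * (3 * Real.log n) * (|A| * Real.log n ^ k) := by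
            have h2 : A * Real.log n ^ k ≤ |A| * Real.log n ^ k :=
              mul_le_mul_of_nonneg_right (le_abs_self A) (by positivity)
            refine mul_le_mul_of_nonneg_left h2 (by positivity) |>.trans ?_
            refine mul_le_mul_of_nonneg_right ?_ (by positivity)
            exact mul_le_mul_of_nonneg_left (by linarith) hK
        _ = _ := by ring

end

end EuclLattice

end

theorem mainTheorem2 :
    (∀ n : ℕ, 1 ≤ n →
      IsLeast {C : ENNReal | ∀ L : Submodule ℤ (EuclLattice.E n),
        EuclLattice.IsLatticeOfDim n L →
          EuclLattice.etaMuCirc L ≤ C * EuclLattice.etaDet L} (EuclLattice.detConst n) ∧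
      IsLeast {C : ENNReal | ∀ L : Submodule ℤ (EuclLattice.E n),
        EuclLattice.IsLattice L →
          EuclLattice.coveringRadius L ≤ C * EuclLattice.klBound L} (EuclLattice.klConst n) ∧
      0 < EuclLattice.detConst n ∧
      EuclLattice.detConst n ≤ EuclLattice.klConst n ∧
      EuclLattice.klConst n < ⊤) ∧
    (∃ K : ℝ, 0 < K ∧ ∀ n : ℕ, 1 ≤ n →
      EuclLattice.klConst n ≤
        ENNReal.ofReal (K * (1 + Real.log n)) * EuclLattice.detConst n) ∧
    (EuclLattice.KLConjecture ↔ EuclLattice.PolylogBounded EuclLattice.detConst) := by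
  open EuclLattice in
  exact ⟨fun n hn => ⟨isLeast_detConst hn, isLeast_klConst n, detConst_pos hn,
      detConst_le_klConst n, klConst_lt_top n⟩,
    ⟨2, two_pos, fun n hn => klConst_le_log_mul_detConst hn⟩,
    fun h => PolylogBounded.of_le detConst_le_klConst h,
    fun h => PolylogBounded.of_le_log_mul zero_le_two (fun n hn => klConst_le_log_mul_detConst hn)
      h⟩
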